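/- **Setting.** Let $\kappa:\mathcal X\times\mathcal X\to\mathbb R$ be a positive, infinitely divisible kernel, i.e. $\kappa\ge 0$ and for every real $r>0$ all matrices $[\kappa(y_i,y_j)^r]_{i,j}$ are symmetric positive semidefinite. For $n\ge 1$ and points $x_1,\dots,x_n\in\mathcal X$ with $\kappa(x_i,x_i)>0$, let $A\in\mathbb R^{n\times n}$ be the normalized kernel matrix $$A_{ij}=\frac1n\,\frac{\kappa(x_i,x_j)}{\sqrt{\kappa(x_i,x_i)\,\kappa(x_j,x_j)}},$$ and for an integer $\alpha\ge 2$ let $S_\alpha(A)=\frac{1}{1-\alpha}\log \operatorname{tr}(A^\alpha)$ be its matrix-based Rényi entropy. **Algorithm.** Let $s$ be a multiple of $4$, and let $B=A^\alpha$ be accessible through matrix-vector products only. The algorithm applies Hutch++ to $B$: sample $S\in\mathbb R^{n\times s/4}$ and $G\in\mathbb R^{n\times s/2}$ with i.i.d. standard Gaussian entries (all entries of $S$ and $G$ independent), compute a matrix $Q$ whose columns form an orthonormal basis of the column span of $BS$, and put $$Z=\operatorname{tr}\bigl(Q^\top BQ\bigr)+\frac2s\operatorname{tr}\bigl(G^\top(I-QQ^\top)B(I-QQ^\top)G\bigr).$$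 It returns $\tilde S_\alpha(A)=\frac1{1-\alpha}\log Z$. **Theorem.** For every $\delta_0<1$ there is a constant $C>0$, depending only on $\delta_0$, such that the following holds for all $\kappa$, $n$, $x_1,\dots,x_n$ and $A$ as above, all integers $\alpha\ge2$, all $\varepsilon>0$, all $0<\delta\le\delta_0$, and every multiple $s$ of $4$ with $$s\;\ge\; C\left(\frac1\varepsilon\sqrt{\log\frac1\delta}+\log\frac1\delta\right).$$ The algorithm makes at most $s$ matrix-vector multiplication queries to $A^\alpha$, and, whichever orthonormal bases $Q$ are chosen as a function of $BS$, with probability at least $1-\delta$ one has $Z>0$ and $$\bigl|\tilde S_\alpha(A)-S_\alpha(A)\bigr|\le\varepsilon\, S_\alpha(A).$$ Thus $s=O\!\left(\frac1\varepsilon\sqrt{\log\frac1\delta}+\log\frac1\delta\right)$ queries suffice. -/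

import Mathlib

open MeasureTheory ProbabilityTheory
open scoped Matrix

noncomputable section

/-- A positive, infinitely divisible kernel `κ : 𝒳 × 𝒳 → ℝ`: all values are non-negative and, for
every real `r > 0`, the entrywise `r`-th power of every Gram matrix of `κ` is positive semidefinite
(`r = 1` says that `κ` itself is a positive kernel). -/
def IsInfinitelyDivisibleKernel {𝒳 : Type*} (κ : 𝒳 → 𝒳 → ℝ) : Prop :=
  (∀ x y, 0 ≤ κ x y) ∧
    ∀ r : ℝ, 0 < r → ∀ (m : ℕ) (x : Fin m → 𝒳),
      (Matrix.of fun i j => κ (x i) (x j) ^ r).PosSemidef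

/-- The normalized kernel matrix `A i j = (1 / n) * K i j / √(K i i * K j j)` of the sample
`x 0, …, x (n - 1)`, where `K i j = κ (x i) (x j)`. -/
def normalizedKernelMatrix {𝒳 : Type*} {n : ℕ} (κ : 𝒳 → 𝒳 → ℝ) (x : Fin n → 𝒳) :
    Matrix (Fin n) (Fin n) ℝ :=
  Matrix.of fun i j =>
    (1 / (n : ℝ)) * (κ (x i) (x j) / √(κ (x i) (x i) * κ (x j) (x j)))

/-- The matrix-based Rényi entropy `S_α(A) = (1 / (1 - α)) * log (tr (A ^ α))` of integer order. -/
def renyiEntropy {n : ℕ} (α : ℕ) (A : Matrix (Fin n) (Fin n) ℝ) : ℝ :=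
  1 / (1 - (α : ℝ)) * Real.log (A ^ α).trace

/-- Adaptive computations that access an implicit `n × n` matrix through matrix-vector
multiplication queries only. -/
inductive MatVecProg (n : ℕ) (β : Type) : Type
  | done (b : β) : MatVecProg n β
  | query (v : Fin n → ℝ) (next : (Fin n → ℝ) → MatVecProg n β) : MatVecProg n β

namespace MatVecProg

variable {n : ℕ} {β : Type}

/-- The result of the computation when every query `v` is answered by `B *ᵥ v`. -/
def output (B : Matrix (Fin n) (Fin n) ℝ) : MatVecProg n β → β
  | done b => b
  | query v next => output B (next (B *ᵥ v))

/-- The number of matrix-vector multiplications with `B` that the computation makes. -/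
def queries (B : Matrix (Fin n) (Fin n) ℝ) : MatVecProg n β → ℕ
  | done _ => 0
  | query v next => queries B (next (B *ᵥ v)) + 1

/-- Query `m` vectors one after the other, and go on with the family of the answers. -/
def queryAll : (m : ℕ) → (Fin m → Fin n → ℝ) →
    ((Fin m → Fin n → ℝ) → MatVecProg n β) → MatVecProg n β
  | 0, _, next => next Fin.elim0
  | m + 1, X, next => query (X 0) fun y =>
      queryAll m (fun j => X j.succ) fun Y => next (Fin.cons y Y)

/-- Query all columns of `X`, and go on with the matrix whose columns are the answers. -/
def queryMatrix {m : ℕ} (X : Matrix (Fin n) (Fin m) ℝ)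
    (next : Matrix (Fin n) (Fin m) ℝ → MatVecProg n β) : MatVecProg n β :=
  queryAll m (fun j i => X i j) fun Y => next (Matrix.of fun i j => Y j i)

theorem output_queryAll (B : Matrix (Fin n) (Fin n) ℝ) (m : ℕ) (X : Fin m → Fin n → ℝ)
    (next : (Fin m → Fin n → ℝ) → MatVecProg n β) :
    (queryAll m X next).output B = (next fun j => B *ᵥ X j).output B := by
  induction m with
  | zero =>
    simp only [queryAll]
    congr 2
    exact funext fun j => j.elim0
  | succ m ih =>
    simp only [queryAll, output, ih]
    congr 2
    funext j
    refine Fin.cases ?_ (fun i => ?_) j <;> simp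

theorem queries_queryAll (B : Matrix (Fin n) (Fin n) ℝ) (m : ℕ) (X : Fin m → Fin n → ℝ)
    (next : (Fin m → Fin n → ℝ) → MatVecProg n β) :
    (queryAll m X next).queries B = (next fun j => B *ᵥ X j).queries B + m := by
  induction m with
  | zero =>
    simp only [queryAll, Nat.add_zero]
    congr 2
    exact funext fun j => j.elim0
  | succ m ih =>
    simp only [queryAll, queries, ih, Nat.add_assoc]
    congr 3
    funext j
    refine Fin.cases ?_ (fun i => ?_) j <;> simp

theorem output_queryMatrix (B : Matrix (Fin n) (Fin n) ℝ) {m : ℕ} (X : Matrix (Fin n) (Fin m) ℝ)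
    (next : Matrix (Fin n) (Fin m) ℝ → MatVecProg n β) :
    (queryMatrix X next).output B = (next (B * X)).output B := by
  simp only [queryMatrix, output_queryAll]
  rfl

theorem queries_queryMatrix (B : Matrix (Fin n) (Fin n) ℝ) {m : ℕ} (X : Matrix (Fin n) (Fin m) ℝ)
    (next : Matrix (Fin n) (Fin m) ℝ → MatVecProg n β) :
    (queryMatrix X next).queries B = (next (B * X)).queries B + m := by
  simp only [queryMatrix, queries_queryAll]
  rfl

end MatVecProg

/-- `orth` is an orthonormalization routine (such as the one given by a QR decomposition): it
returns a matrix `Q` with orthonormal columns that form a basis of the column span of its input.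
The number of columns of `Q` is the rank of the input. -/
def IsOrthonormalization {n k : ℕ}
    (orth : Matrix (Fin n) (Fin k) ℝ → Σ q : ℕ, Matrix (Fin n) (Fin q) ℝ) : Prop :=
  ∀ Y, (orth Y).2ᵀ * (orth Y).2 = 1 ∧
    LinearMap.range (orth Y).2.mulVecLin = LinearMap.range Y.mulVecLin

theorem exists_isOrthonormalization (n k : ℕ) :
    ∃ orth : Matrix (Fin n) (Fin k) ℝ → Σ q : ℕ, Matrix (Fin n) (Fin q) ℝ,
      IsOrthonormalization orth := by
  have key : ∀ Y : Matrix (Fin n) (Fin k) ℝ, ∃ Q : Σ q : ℕ, Matrix (Fin n) (Fin q) ℝ,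
      Q.2ᵀ * Q.2 = 1 ∧ LinearMap.range Q.2.mulVecLin = LinearMap.range Y.mulVecLin := by
    intro Y
    let e := (WithLp.linearEquiv 2 ℝ (Fin n → ℝ)).symm
    let W : Submodule ℝ (EuclideanSpace ℝ (Fin n)) :=
      (LinearMap.range Y.mulVecLin).map e.toLinearMap
    let b := stdOrthonormalBasis ℝ W
    refine ⟨⟨_, Matrix.of fun i j => (b j : EuclideanSpace ℝ (Fin n)) i⟩, ?_, ?_⟩
    · ext i j
      have h := orthonormal_iff_ite.1 b.orthonormal i j
      rw [Submodule.coe_inner, PiLp.inner_apply] at h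
      rw [Matrix.mul_apply, Matrix.one_apply, ← h]
      exact Finset.sum_congr rfl fun a _ => mul_comm _ _
    · rw [Matrix.range_mulVecLin]
      have hs : Submodule.span ℝ (Set.range fun j => (b j : EuclideanSpace ℝ (Fin n))) = W := by
        have h := b.toBasis.span_eq
        have h2 := congrArg (Submodule.map W.subtype) h
        rw [Submodule.map_span, Submodule.map_top, Submodule.range_subtype, ← Set.range_comp] at h2
        simpa [Function.comp_def] using h2
      have h3 := congrArg (Submodule.map e.symm.toLinearMap) hs
      rw [Submodule.map_span, ← Set.range_comp, ← Submodule.map_comp] at h3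
      simp only [LinearEquiv.comp_coe, LinearEquiv.self_trans_symm,
        LinearEquiv.refl_toLinearMap, Submodule.map_id] at h3
      exact h3
  choose f hf using key
  exact ⟨f, hf⟩

/-- The Hutch++ trace estimator for an implicit matrix `B`, with the random sketches `S` and `G`:
compute an orthonormal basis `Q` of the span of `B * S`, and return
`tr (Qᵀ B Q) + (2 / s) tr (Gᵀ (1 - Q Qᵀ) B (1 - Q Qᵀ) G)`. -/
def hutchPP {n : ℕ} (s : ℕ)
    (orth : Matrix (Fin n) (Fin (s / 4)) ℝ → Σ q : ℕ, Matrix (Fin n) (Fin q) ℝ)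
    (S : Matrix (Fin n) (Fin (s / 4)) ℝ) (G : Matrix (Fin n) (Fin (s / 2)) ℝ) : MatVecProg n ℝ :=
  .queryMatrix S fun BS =>
    let Q := (orth BS).2
    .queryMatrix Q fun BQ =>
      .queryMatrix ((1 - Q * Qᵀ) * G) fun V =>
        .done ((Qᵀ * BQ).trace + 2 / (s : ℝ) * (Gᵀ * (1 - Q * Qᵀ) * V).trace)

theorem output_hutchPP {n s : ℕ}
    (orth : Matrix (Fin n) (Fin (s / 4)) ℝ → Σ q : ℕ, Matrix (Fin n) (Fin q) ℝ)
    (S : Matrix (Fin n) (Fin (s / 4)) ℝ) (G : Matrix (Fin n) (Fin (s / 2)) ℝ)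
    (B : Matrix (Fin n) (Fin n) ℝ) :
    (hutchPP s orth S G).output B =
      ((orth (B * S)).2ᵀ * B * (orth (B * S)).2).trace + 2 / (s : ℝ) *
        (Gᵀ * (1 - (orth (B * S)).2 * (orth (B * S)).2ᵀ) * B *
          (1 - (orth (B * S)).2 * (orth (B * S)).2ᵀ) * G).trace := by
  simp only [hutchPP, MatVecProg.output_queryMatrix, MatVecProg.output, Matrix.mul_assoc]

theorem queries_hutchPP {n s : ℕ}
    (orth : Matrix (Fin n) (Fin (s / 4)) ℝ → Σ q : ℕ, Matrix (Fin n) (Fin q) ℝ)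
    (S : Matrix (Fin n) (Fin (s / 4)) ℝ) (G : Matrix (Fin n) (Fin (s / 2)) ℝ)
    (B : Matrix (Fin n) (Fin n) ℝ) :
    (hutchPP s orth S G).queries B = s / 2 + (orth (B * S)).1 + s / 4 := by
  simp [hutchPP, MatVecProg.queries_queryMatrix, MatVecProg.queries]

/-- The integer-order estimate of `S_α(A)`: run Hutch++ on the implicit matrix `A ^ α`, and return
`(1 / (1 - α)) * log Z`, where `Z` is its output. -/
def renyiEstimate {n : ℕ} (α s : ℕ)
    (orth : Matrix (Fin n) (Fin (s / 4)) ℝ → Σ q : ℕ, Matrix (Fin n) (Fin q) ℝ)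
    (S : Matrix (Fin n) (Fin (s / 4)) ℝ) (G : Matrix (Fin n) (Fin (s / 2)) ℝ)
    (A : Matrix (Fin n) (Fin n) ℝ) : ℝ :=
  1 / (1 - (α : ℝ)) * Real.log ((hutchPP s orth S G).output (A ^ α))

/-- The law of an `n × k` matrix with independent standard Gaussian entries. -/
def gaussianMatrix (n k : ℕ) : Measure (Fin n → Fin k → ℝ) :=
  Measure.pi fun _ => Measure.pi fun _ => gaussianReal 0 1

end

/-!
The kernel matrix `A` is positive semidefinite of trace `1`, with eigenvalues `lᵢ`, and
`B = A ^ α` has the eigenvalues `lᵢ ^ α`. Write `t = tr B ≤ 1`, so that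
`S_α(A) = log (1 / t) / (α - 1)`. As the entropy may be arbitrarily small, an error of `Z` that is
small relative to `t` is not enough. What helps is that Hutch++ does not see a dominant eigenvector:
its error is of order `√L / k * T`, where `k = s / 4`, `L` is `log (1 / δ)` up to a constant
depending on `δ₀`, and `T` is the trace of `B` *outside a top eigenvector*. With the top eigenvalue
`p` of `A`, `T ≤ 2 t (1 - p) ≤ 2 t log (1 / t)` (`exists_tail_le_entropy`), and this turns the
additive error into an error of `log Z` relative to `log (1 / t)` (`abs_renyi_sub_le`).

The error `Z - tr B` is the Hutchinson error, with `2k` samples, for `R B R`, where `R` projects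
onto the complement of the range of `B S`. Hence it is of order `‖R B R‖_F √(L / k)` by a Chernoff
bound for Gaussian quadratic forms (`measure_quadratic_form_gt_le`), which rests on the rotation
invariance of Gaussian matrices, and it remains to show `‖R B R‖_F ≲ T / √k`. Let `I` be a set of
`r ≈ k / 608` eigenvectors that contains all large eigenvalues, so that the squares of the others add
up to at most `T ^ 2 / r` (`exists_large_indices`). In the eigenbasis, `R B S = 0` expresses the
rows of `S` in `I`, weighted by the entries of `B R`, through the rows outside `I`. If these `r`
rows of length `k` are well conditioned, this bounds the part of `B R` in `I` by the part outside
`I` (`frobenius_diagonal_mul_projection_le`). Well-conditioning (`lower_bound_of_lattice`) follows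
from a union bound over the integer vectors of squared length about `16 r`. A real vector is rounded
to an integer one coordinate by coordinate, each time in the direction that is not worse than the
average of an unbiased random rounding (`exists_rounding`), so that only the trace of the Gram
matrix has to be bounded, and not its norm.
-/

/-! ### Gaussian matrices and their rotation invariance -/

instance isProbabilityMeasure_gaussianMatrix (n k : ℕ) :
    IsProbabilityMeasure (gaussianMatrix n k) := by
  unfold gaussianMatrix; infer_instance

theorem charFunDual_gaussianReal_std (L : StrongDual ℝ ℝ) :
    charFunDual (gaussianReal 0 1) L = Complex.exp (-((L 1 : ℝ) : ℂ) ^ 2 / 2) := by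
  have h : ∀ x, L x = L 1 * x := fun x => by
    have := L.map_smul x 1
    simpa [mul_comm] using this
  have h2 : (L : ℝ → ℝ) = fun x => L 1 * x := funext h
  rw [charFunDual_eq_charFun_map_one, h2, gaussianReal_map_const_mul, charFun_gaussianReal]
  congr 1
  simp
  ring

theorem charFunDual_gaussianMatrix {n k : ℕ} (L : StrongDual ℝ (Fin n → Fin k → ℝ)) :
    charFunDual (gaussianMatrix n k) L =
      Complex.exp (((-(∑ i, ∑ a, (L (Pi.single i (Pi.single a 1))) ^ 2) / 2 : ℝ)) : ℂ) := by
  unfold gaussianMatrix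
  rw [charFunDual_pi]
  simp_rw [charFunDual_pi, charFunDual_gaussianReal_std]
  simp_rw [← Complex.exp_sum]
  congr 1
  push_cast
  rw [← Finset.sum_neg_distrib, Finset.sum_div]
  refine Finset.sum_congr rfl fun i _ => ?_
  rw [← Finset.sum_neg_distrib, Finset.sum_div]
  refine Finset.sum_congr rfl fun a _ => ?_
  simp

/-- Gaussian matrices are invariant under rotations of their columns: the characteristic function
at a functional depends on the sum of squares of its coefficients only. -/
theorem map_mul_gaussianMatrix {n k : ℕ} (U : Matrix (Fin n) (Fin n) ℝ) (hU : U * Uᵀ = 1) :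
    (gaussianMatrix n k).map (fun G i a => ∑ j, U i j * G j a) = gaussianMatrix n k := by
  let T : (Fin n → Fin k → ℝ) →ₗ[ℝ] (Fin n → Fin k → ℝ) :=
    { toFun := fun G i a => ∑ j, U i j * G j a
      map_add' := fun G H => by
        ext i a; simp [mul_add, Finset.sum_add_distrib]
      map_smul' := fun c G => by
        ext i a; simp only [Pi.smul_apply, smul_eq_mul, RingHom.id_apply, Finset.mul_sum]
        exact Finset.sum_congr rfl fun j _ => by ring }
  let T' := LinearMap.toContinuousLinearMap T
  have hT' : (fun (G : Fin n → Fin k → ℝ) i a => ∑ j, U i j * G j a) = T' := rfl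
  rw [hT']
  have : IsProbabilityMeasure (Measure.map T' (gaussianMatrix n k)) :=
    Measure.isProbabilityMeasure_map T'.continuous.measurable.aemeasurable
  refine Measure.ext_of_charFunDual (funext fun L => ?_)
  rw [charFunDual_map, charFunDual_gaussianMatrix, charFunDual_gaussianMatrix]
  have hone : ∀ (i : Fin n) (a : Fin k), T' (Pi.single i (Pi.single a 1)) =
      ∑ j, U j i • (Pi.single j (Pi.single a 1) : Fin n → Fin k → ℝ) := by
    intro i a
    change (fun i' a' => ∑ j, U i' j * (Pi.single i (Pi.single a 1) : Fin n → Fin k → ℝ) j a') = _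
    ext i' a'
    by_cases ha : a' = a <;> simp [Finset.sum_apply, Pi.single_apply, apply_ite, ite_apply, ha]
  congr 3
  simp only [ContinuousLinearMap.comp_apply, hone, map_sum, map_smul, smul_eq_mul]
  rw [Finset.sum_comm]
  conv_rhs => rw [Finset.sum_comm]
  congr 1
  refine Finset.sum_congr rfl fun a _ => ?_
  set l : Fin n → ℝ := fun j => L (Pi.single j (Pi.single a 1)) with hl
  have h1 : ∑ i, (∑ j, U j i * l j) ^ 2 = (l ᵥ* U) ⬝ᵥ (l ᵥ* U) := by
    simp [dotProduct, Matrix.vecMul, sq, mul_comm]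
  have h2 : (l ᵥ* U) ⬝ᵥ (l ᵥ* U) = l ⬝ᵥ l := by
    rw [← Matrix.dotProduct_mulVec, ← Matrix.mulVec_transpose U, Matrix.mulVec_mulVec, hU,
      Matrix.one_mulVec]
  change ∑ i, (∑ j, U j i * l j) ^ 2 = ∑ i, l i ^ 2
  rw [h1, h2]
  simp [dotProduct, sq]

/-! ### The exponential moments of a centred squared Gaussian -/

theorem one_le_one_sub_mul_exp {u : ℝ} (hu : |u| ≤ 1 / 2) : 1 ≤ (1 - u) * Real.exp (u + u ^ 2) := by
  obtain ⟨h1, h2⟩ := abs_le.1 hu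
  by_cases h0 : 0 ≤ u
  · have := Real.quadratic_le_exp_of_nonneg (x := u + u ^ 2) (by positivity)
    have hp : 0 ≤ u ^ 2 * (1 - u - u ^ 2 - u ^ 3) := by
      have : u ^ 2 ≤ 1 / 4 := by nlinarith
      have : u ^ 3 ≤ 1 / 8 := by nlinarith
      exact mul_nonneg (sq_nonneg _) (by linarith)
    nlinarith [mul_le_mul_of_nonneg_left this (show (0 : ℝ) ≤ 1 - u by linarith)]
  · push Not at h0
    have h3 : u + u ^ 2 ≤ 0 := by nlinarith
    have := Real.add_one_le_exp (u + u ^ 2)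
    nlinarith [mul_nonneg (neg_nonneg.2 h0.le) (sq_nonneg u)]

theorem integrable_exp_sq_gaussianReal {x : ℝ} (hx : x < 1 / 2) :
    Integrable (fun g : ℝ => Real.exp (x * (g ^ 2 - 1))) (gaussianReal 0 1) := by
  rw [gaussianReal_of_var_ne_zero _ one_ne_zero]
  rw [integrable_withDensity_iff_integrable_smul₀' (by fun_prop) (by simp [gaussianPDF])]
  have h := (integrable_exp_neg_mul_sq (b := 1 / 2 - x) (by linarith)).const_mul
    ((√(2 * Real.pi * 1))⁻¹ * Real.exp (-x))
  refine h.congr (Filter.Eventually.of_forall fun g => ?_)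
  simp only [toReal_gaussianPDF, gaussianPDFReal, smul_eq_mul, NNReal.coe_one]
  rw [mul_assoc (√(2 * Real.pi * 1))⁻¹, mul_assoc (√(2 * Real.pi * 1))⁻¹, ← Real.exp_add,
    ← Real.exp_add]
  congr 2
  ring

theorem integral_exp_sq_gaussianReal_le {x : ℝ} (hx : |x| ≤ 1 / 4) :
    ∫ g : ℝ, Real.exp (x * (g ^ 2 - 1)) ∂(gaussianReal 0 1) ≤ Real.exp (2 * x ^ 2) := by
  obtain ⟨h1, h2⟩ := abs_le.1 hx
  rw [integral_gaussianReal_eq_integral_smul one_ne_zero]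
  have h : ∀ g : ℝ, gaussianPDFReal 0 1 g • Real.exp (x * (g ^ 2 - 1)) =
      ((√(2 * Real.pi))⁻¹ * Real.exp (-x)) * Real.exp (-(1 / 2 - x) * g ^ 2) := by
    intro g
    simp only [gaussianPDFReal, smul_eq_mul, NNReal.coe_one, mul_one]
    rw [mul_assoc, mul_assoc, ← Real.exp_add, ← Real.exp_add]
    congr 2
    ring
  simp_rw [h]
  rw [integral_const_mul, integral_gaussian]
  have h3 : √(Real.pi / (1 / 2 - x)) = √(2 * Real.pi) * (√(1 - 2 * x))⁻¹ := by
    rw [← Real.sqrt_inv, ← Real.sqrt_mul (by positivity)]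
    congr 1
    have : 1 / 2 - x ≠ 0 := by linarith
    have : 1 - 2 * x ≠ 0 := by linarith
    field_simp
  have h4 : √(2 * Real.pi) ≠ 0 := by positivity
  rw [h3, show (√(2 * Real.pi))⁻¹ * Real.exp (-x) * (√(2 * Real.pi) * (√(1 - 2 * x))⁻¹) =
    Real.exp (-x) * (√(1 - 2 * x))⁻¹ by field_simp]
  have h5 : 0 < 1 - 2 * x := by linarith
  rw [← div_eq_mul_inv, div_le_iff₀ (by positivity)]
  have h6 := one_le_one_sub_mul_exp (u := 2 * x) (by rw [abs_mul]; norm_num; linarith)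
  have h7 : 1 ≤ √(1 - 2 * x) * Real.exp (x + 2 * x ^ 2) := by
    rw [show x + 2 * x ^ 2 = (2 * x + (2 * x) ^ 2) / 2 by ring, Real.exp_half,
      ← Real.sqrt_mul h5.le]
    exact Real.one_le_sqrt.2 h6
  calc Real.exp (-x) = Real.exp (-x) * 1 := (mul_one _).symm
    _ ≤ Real.exp (-x) * (√(1 - 2 * x) * Real.exp (x + 2 * x ^ 2)) := by gcongr
    _ = Real.exp (2 * x ^ 2) * √(1 - 2 * x) := by
      rw [mul_left_comm, ← Real.exp_add, mul_comm]
      congr 2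
      ring

/-! ### Concentration of Gaussian quadratic forms -/

theorem exp_weighted_sq_eq_prod {n k : ℕ} (w : Fin n → ℝ) (θ : ℝ) (G : Fin n → Fin k → ℝ) :
    Real.exp (θ * ∑ i, w i * ∑ a, (G i a ^ 2 - 1)) =
      ∏ i, ∏ a, Real.exp (θ * w i * (G i a ^ 2 - 1)) := by
  simp_rw [← Real.exp_sum, Finset.mul_sum, mul_assoc]

theorem integrable_exp_weighted_sq {n k : ℕ} (w : Fin n → ℝ) (θ : ℝ)
    (hθ : ∀ i, |θ * w i| ≤ 1 / 4) :
    Integrable (fun G : Fin n → Fin k → ℝ => Real.exp (θ * ∑ i, w i * ∑ a, (G i a ^ 2 - 1)))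
      (gaussianMatrix n k) := by
  simp_rw [exp_weighted_sq_eq_prod]
  refine Integrable.fintype_prod_dep
    (f := fun i (g : Fin k → ℝ) => ∏ a, Real.exp (θ * w i * (g a ^ 2 - 1))) fun i => ?_
  refine Integrable.fintype_prod_dep
    (f := fun _ (g : ℝ) => Real.exp (θ * w i * (g ^ 2 - 1))) fun a => ?_
  exact integrable_exp_sq_gaussianReal (by linarith [(abs_le.1 (hθ i)).2])

theorem mgf_weighted_sq_le {n k : ℕ} (w : Fin n → ℝ) (θ : ℝ) (hθ : ∀ i, |θ * w i| ≤ 1 / 4) :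
    mgf (fun G : Fin n → Fin k → ℝ => ∑ i, w i * ∑ a, (G i a ^ 2 - 1)) (gaussianMatrix n k) θ ≤
      Real.exp (2 * θ ^ 2 * k * ∑ i, w i ^ 2) := by
  unfold mgf
  simp_rw [exp_weighted_sq_eq_prod]
  unfold gaussianMatrix
  rw [integral_fintype_prod_eq_prod
    (f := fun i (g : Fin k → ℝ) => ∏ a, Real.exp (θ * w i * (g a ^ 2 - 1)))]
  have h : ∀ i, ∫ g : Fin k → ℝ, ∏ a, Real.exp (θ * w i * (g a ^ 2 - 1))
      ∂(Measure.pi fun _ => gaussianReal 0 1) ≤ Real.exp (2 * (θ * w i) ^ 2) ^ k := by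
    intro i
    rw [integral_fintype_prod_eq_pow (fun g : ℝ => Real.exp (θ * w i * (g ^ 2 - 1))),
      Fintype.card_fin]
    exact pow_le_pow_left₀ (integral_nonneg fun _ => (Real.exp_pos _).le)
      (integral_exp_sq_gaussianReal_le (hθ i)) k
  refine (Finset.prod_le_prod (fun i _ => integral_nonneg fun _ =>
    Finset.prod_nonneg fun _ _ => (Real.exp_pos _).le) fun i _ => h i).trans (le_of_eq ?_)
  simp_rw [← Real.exp_nat_mul, ← Real.exp_sum, Finset.mul_sum]
  congr 1
  exact Finset.sum_congr rfl fun i _ => by ring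

/-- The Chernoff bound, for the exponent `√(L / k) / F`. The restriction `L ≤ k / 16` keeps all
exponents in the range where the moment bound holds. -/
theorem measure_weighted_sq_ge_le {n k : ℕ} (hk : 0 < k) (w : Fin n → ℝ) {F L : ℝ} (hF : 0 < F)
    (hw : ∑ i, w i ^ 2 ≤ F ^ 2) (hL0 : 0 ≤ L) (hL : L ≤ k / 16) :
    (gaussianMatrix n k).real
      {G | 3 * F * √(L * k) ≤ ∑ i, w i * ∑ a, (G i a ^ 2 - 1)} ≤ Real.exp (-L) := by
  have hk' : (0 : ℝ) < k := by exact_mod_cast hk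
  set θ : ℝ := √(L / k) / F with hθ
  have hθ0 : 0 ≤ θ := by positivity
  have hs : √(L / k) ≤ 1 / 4 := by
    rw [Real.sqrt_le_left (by norm_num), div_le_iff₀ hk']
    linarith
  have hwi : ∀ i, |w i| ≤ F := fun i => by
    refine abs_le_of_sq_le_sq ((Finset.single_le_sum (f := fun i => w i ^ 2)
      (fun i _ => sq_nonneg _) (Finset.mem_univ i)).trans hw) hF.le
  have hθw : ∀ i, |θ * w i| ≤ 1 / 4 := fun i => by
    rw [abs_mul, abs_of_nonneg hθ0]
    calc θ * |w i| ≤ θ * F := mul_le_mul_of_nonneg_left (hwi i) hθ0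
      _ = √(L / k) := by rw [hθ]; field_simp
      _ ≤ 1 / 4 := hs
  refine (measure_ge_le_exp_mul_mgf _ hθ0 (integrable_exp_weighted_sq w θ hθw)).trans ?_
  have hsq : √(L / k) * √(L * k) = L := by
    rw [← Real.sqrt_mul (by positivity), show L / k * (L * k) = L ^ 2 by field_simp,
      Real.sqrt_sq hL0]
  have e1 : -θ * (3 * F * √(L * k)) = -(3 * L) := by
    calc -θ * (3 * F * √(L * k)) = -(3 * (√(L / k) * √(L * k))) := by rw [hθ]; field_simp
      _ = -(3 * L) := by rw [hsq]
  have e2 : 2 * θ ^ 2 * k * ∑ i, w i ^ 2 ≤ 2 * L := by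
    calc 2 * θ ^ 2 * k * ∑ i, w i ^ 2 ≤ 2 * θ ^ 2 * k * F ^ 2 := by gcongr
      _ = 2 * √(L / k) ^ 2 * k := by rw [hθ]; field_simp
      _ = 2 * L := by rw [Real.sq_sqrt (by positivity)]; field_simp
  rw [e1]
  calc _ ≤ Real.exp (-(3 * L)) * Real.exp (2 * L) := by
        gcongr
        exact (mgf_weighted_sq_le w θ hθw).trans (Real.exp_le_exp.2 e2)
    _ = Real.exp (-L) := by rw [← Real.exp_add]; congr 1; ring

theorem measure_abs_weighted_sq_gt_le {n k : ℕ} (hk : 0 < k) (w : Fin n → ℝ) {F L : ℝ} (hF : 0 ≤ F)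
    (hw : ∑ i, w i ^ 2 ≤ F ^ 2) (hL0 : 0 ≤ L) (hL : L ≤ k / 16) :
    (gaussianMatrix n k).real
      {G | 3 * F * √(L * k) < |∑ i, w i * ∑ a, (G i a ^ 2 - 1)|} ≤ 2 * Real.exp (-L) := by
  rcases hF.eq_or_lt with rfl | hF
  · -- all weights vanish, and so does the deviation
    have h0 : ∀ i, w i = 0 := fun i => by
      have h1 := (Finset.single_le_sum (f := fun i => w i ^ 2)
        (fun i _ => sq_nonneg _) (Finset.mem_univ i)).trans hw
      exact pow_eq_zero_iff two_ne_zero |>.1 (le_antisymm (by simpa using h1) (sq_nonneg _))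
    simp [h0, Real.exp_nonneg]
  · have h1 := measure_weighted_sq_ge_le hk w hF hw hL0 hL
    have h2 := measure_weighted_sq_ge_le hk (fun i => -w i) hF (by simpa using hw) hL0 hL
    rw [two_mul]
    refine (measureReal_mono ?_).trans ((measureReal_union_le _ _).trans (add_le_add h1 h2))
    intro G hG
    rw [Set.mem_ofPred_eq] at hG
    rcases lt_abs.1 hG with h | h
    · exact Or.inl h.le
    · refine Or.inr ?_
      simpa [Finset.sum_neg_distrib] using h.le

/-- The spectral theorem, for the transpose `U` of the matrix of eigenvectors. -/
theorem exists_orthogonal_diagonalization {n : ℕ} {M : Matrix (Fin n) (Fin n) ℝ}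
    (hM : M.IsHermitian) : ∃ U : Matrix (Fin n) (Fin n) ℝ, U * Uᵀ = 1 ∧ Uᵀ * U = 1 ∧
      M = Uᵀ * Matrix.diagonal hM.eigenvalues * U := by
  refine ⟨(hM.eigenvectorUnitary : Matrix (Fin n) (Fin n) ℝ)ᵀ, ?_, ?_, ?_⟩
  · have := Matrix.UnitaryGroup.star_mul_self hM.eigenvectorUnitary
    simpa [Matrix.star_eq_conjTranspose] using this
  · have := Unitary.mul_star_self_of_mem hM.eigenvectorUnitary.2
    simpa [Matrix.star_eq_conjTranspose] using this
  · conv_lhs => rw [hM.spectral_theorem]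
    simp [Unitary.conjStarAlgAut_apply, Matrix.star_eq_conjTranspose]

theorem trace_transpose_diagonal_mul {n k : ℕ} (d : Fin n → ℝ) (G : Matrix (Fin n) (Fin k) ℝ) :
    (Gᵀ * Matrix.diagonal d * G).trace = ∑ i, d i * ∑ a, G i a ^ 2 := by
  have h : (Gᵀ * Matrix.diagonal d * G).trace = ∑ a, ∑ i, G i a * d i * G i a := by
    refine Finset.sum_congr rfl fun a _ => ?_
    rw [Matrix.diag_apply, Matrix.mul_apply]
    simp only [Matrix.mul_diagonal, Matrix.transpose_apply]
  rw [h]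
  rw [Finset.sum_comm]
  refine Finset.sum_congr rfl fun i _ => ?_
  rw [Finset.mul_sum]
  exact Finset.sum_congr rfl fun a _ => by ring

/-- The trace estimator of Hutchinson with `k` Gaussian samples, in terms of any bound `F` on the
Frobenius norm of `M`: a Hanson-Wright inequality for moderate deviations. -/
theorem measure_quadratic_form_gt_le {n k : ℕ} (hk : 0 < k) {M : Matrix (Fin n) (Fin n) ℝ}
    (hM : M.IsHermitian) {F L : ℝ} (hF : 0 ≤ F) (hMF : (Mᵀ * M).trace ≤ F ^ 2)
    (hL0 : 0 ≤ L) (hL : L ≤ k / 16) :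
    (gaussianMatrix n k).real
      {G | 3 * F * √(L * k) < |((Matrix.of G)ᵀ * M * Matrix.of G).trace - k * M.trace|} ≤
        2 * Real.exp (-L) := by
  obtain ⟨U, h1, h2, h3⟩ := exists_orthogonal_diagonalization hM
  set d := hM.eigenvalues with hd
  have htr : M.trace = ∑ i, d i := by
    rw [h3, Matrix.trace_mul_comm, ← Matrix.mul_assoc, h1, Matrix.one_mul, Matrix.trace_diagonal]
  have htr2 : (Mᵀ * M).trace = ∑ i, d i ^ 2 := by
    have : Mᵀ * M = Uᵀ * Matrix.diagonal (fun i => d i ^ 2) * U := by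
      conv_lhs => rw [h3]
      simp only [Matrix.transpose_mul, Matrix.transpose_transpose, Matrix.diagonal_transpose]
      calc Uᵀ * (Matrix.diagonal d * U) * (Uᵀ * Matrix.diagonal d * U)
          = Uᵀ * (Matrix.diagonal d * (U * Uᵀ) * Matrix.diagonal d) * U := by
            simp only [Matrix.mul_assoc]
        _ = _ := by
            rw [h1, Matrix.mul_one, Matrix.diagonal_mul_diagonal]
            simp only [sq]
    rw [this, Matrix.trace_mul_comm, ← Matrix.mul_assoc, h1, Matrix.one_mul, Matrix.trace_diagonal]
  have hmain := measure_abs_weighted_sq_gt_le hk d hF (htr2 ▸ hMF) hL0 hL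
  rw [← map_mul_gaussianMatrix U h1, map_measureReal_apply] at hmain
  rotate_left
  · fun_prop
  · refine measurableSet_lt measurable_const ?_
    fun_prop
  refine le_trans (le_of_eq ?_) hmain
  congr 1
  ext G
  simp only [Set.mem_ofPred_eq, Set.mem_preimage]
  have : ((Matrix.of G)ᵀ * M * Matrix.of G).trace - k * M.trace =
      ∑ i, d i * ∑ a, ((∑ j, U i j * G j a) ^ 2 - 1) := by
    rw [htr, h3, show (Matrix.of G)ᵀ * (Uᵀ * Matrix.diagonal d * U) * Matrix.of G =
      (U * Matrix.of G)ᵀ * Matrix.diagonal d * (U * Matrix.of G) by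
        simp only [Matrix.transpose_mul, Matrix.mul_assoc], trace_transpose_diagonal_mul,
        Finset.mul_sum, ← Finset.sum_sub_distrib]
    refine Finset.sum_congr rfl fun i _ => ?_
    simp [Matrix.mul_apply, Finset.sum_sub_distrib]
    ring
  rw [this]

/-! ### Well-conditioned Gaussian matrices through a lattice net -/

/-- Derandomized unbiased rounding: rounding a coordinate up or down at random, without changing its
mean, increases the expectation of the quadratic form `y ↦ ‖Sᵀ y‖ ^ 2` by at most a quarter of the
diagonal entry, so that one of the two choices does. -/
theorem exists_rounding {n k : ℕ} (S : Matrix (Fin n) (Fin k) ℝ) (y : Fin n → ℝ)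
    (I : Finset (Fin n)) : ∃ z : Fin n → ℝ, (∀ i ∈ I, ∃ m : ℤ, z i = m) ∧ (∀ i ∉ I, z i = y i) ∧
      (∀ i, (z i - y i) ^ 2 ≤ 1) ∧
      ∑ a, (∑ i, z i * S i a) ^ 2 ≤
        ∑ a, (∑ i, y i * S i a) ^ 2 + 1 / 4 * ∑ i ∈ I, ∑ a, S i a ^ 2 := by
  induction I using Finset.induction_on with
  | empty => exact ⟨y, by simp, by simp, by simp, by simp⟩
  | insert i I hi ih =>
    obtain ⟨z, h1, h2, h3, h4⟩ := ih
    set V := ∑ a, (∑ i, z i * S i a) ^ 2 with hV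
    set W := ∑ a, S i a ^ 2 with hW
    set b := ∑ a, (∑ i, z i * S i a) * S i a with hb
    have hstep : ∀ t : ℝ, ∑ a, (∑ j, (z j + if j = i then t else 0) * S j a) ^ 2 =
        V + 2 * t * b + t ^ 2 * W := by
      intro t
      rw [hV, hb, hW, Finset.mul_sum, Finset.mul_sum, ← Finset.sum_add_distrib,
        ← Finset.sum_add_distrib]
      refine Finset.sum_congr rfl fun a _ => ?_
      have : ∑ j, (z j + if j = i then t else 0) * S j a = ∑ j, z j * S j a + t * S i a := by
        simp [add_mul, Finset.sum_add_distrib]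
      rw [this]
      ring
    have hW0 : 0 ≤ W := Finset.sum_nonneg fun _ _ => sq_nonneg _
    set f := Int.fract (y i) with hf
    have hf0 : 0 ≤ f := Int.fract_nonneg _
    have hf1 : f < 1 := Int.fract_lt_one _
    have hyf : y i = ⌊y i⌋ + f := (Int.floor_add_fract _).symm
    -- weighted by `1 - f` and `f`, the two roundings of `y i` raise the form by `f * (1 - f) * W`
    obtain ⟨t, ⟨m, hm⟩, ht1, ht⟩ : ∃ t : ℝ, (∃ m : ℤ, y i + t = m) ∧ t ^ 2 ≤ 1 ∧
        V + 2 * t * b + t ^ 2 * W ≤ V + 1 / 4 * W := by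
      by_contra! hcon
      have c1 := hcon (-f) ⟨⌊y i⌋, by linarith⟩ (by nlinarith)
      have c2 := hcon (1 - f) ⟨⌊y i⌋ + 1, by push_cast; linarith⟩ (by nlinarith)
      have d1 := mul_le_mul_of_nonneg_left c1.le (show 0 ≤ 1 - f by linarith)
      rcases hf0.eq_or_lt with h0 | h0
      · rw [← h0] at c1
        nlinarith
      · have d2 := mul_lt_mul_of_pos_left c2 h0
        nlinarith [mul_nonneg hW0 (sq_nonneg (f - 1 / 2))]
    refine ⟨fun j => z j + if j = i then t else 0, ?_, ?_, ?_, ?_⟩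
    · intro j hj
      rcases Finset.mem_insert.1 hj with rfl | hj
      · exact ⟨m, by simp [h2 j hi, hm]⟩
      · have : j ≠ i := fun h => hi (h ▸ hj)
        simpa [this] using h1 j hj
    · intro j hj
      rw [Finset.mem_insert, not_or] at hj
      simpa [hj.1] using h2 j hj.2
    · intro j
      by_cases hj : j = i
      · subst hj
        simpa [h2 j hi] using ht1
      · simpa [hj] using h3 j
    · rw [hstep, Finset.sum_insert hi]
      linarith

theorem sum_half_pow_natAbs_le (m : ℕ) :
    ∑ z ∈ Finset.Icc (-(m : ℤ)) m, (1 / 2 : ℝ) ^ z.natAbs ≤ 4 := by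
  have hsub : Finset.Icc (-(m : ℤ)) m ⊆ (Finset.range (m + 1)).image (fun j : ℕ => (j : ℤ)) ∪
      (Finset.range (m + 1)).image (fun j : ℕ => -(j : ℤ)) := by
    intro z hz
    rw [Finset.mem_Icc] at hz
    simp only [Finset.mem_union, Finset.mem_image, Finset.mem_range]
    rcases le_total 0 z with h | h
    · exact Or.inl ⟨z.natAbs, by omega, by omega⟩
    · exact Or.inr ⟨z.natAbs, by omega, by omega⟩
  have hgeom : ∑ j ∈ Finset.range (m + 1), (1 / 2 : ℝ) ^ j ≤ 2 := sum_geometric_two_le _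
  have hnn : ∀ z : ℤ, (0 : ℝ) ≤ (1 / 2 : ℝ) ^ z.natAbs := fun z => by positivity
  calc _ ≤ _ := Finset.sum_le_sum_of_subset_of_nonneg hsub fun z _ _ => hnn z
    _ ≤ ∑ z ∈ (Finset.range (m + 1)).image (fun j : ℕ => (j : ℤ)), (1 / 2 : ℝ) ^ z.natAbs +
        ∑ z ∈ (Finset.range (m + 1)).image (fun j : ℕ => -(j : ℤ)), (1 / 2 : ℝ) ^ z.natAbs := by
      rw [← Finset.sum_union_inter]
      exact le_add_of_nonneg_right (Finset.sum_nonneg fun z _ => hnn z)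
    _ ≤ 2 + 2 := by
      refine add_le_add ?_ ?_
      · rw [Finset.sum_image (by intro a _ b _ h; simpa using h)]
        simpa using hgeom
      · rw [Finset.sum_image (by intro a _ b _ h; simpa using h)]
        simpa using hgeom
    _ = 4 := by norm_num

/-- The integer vectors with support in `I` and squared Euclidean norm at most `25 * r`. -/
noncomputable def latticeNet {n : ℕ} (I : Finset (Fin n)) (r : ℕ) : Finset (Fin n → ℤ) :=
  (Fintype.piFinset fun i =>
    if i ∈ I then Finset.Icc (-((25 * r : ℕ) : ℤ)) ((25 * r : ℕ) : ℤ) else {0}).filter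
      fun z => ∑ i, z i ^ 2 ≤ 25 * r

theorem mem_latticeNet {n : ℕ} {I : Finset (Fin n)} {r : ℕ} {z : Fin n → ℤ}
    (hz : ∀ i ∉ I, z i = 0) (hzr : ∑ i, z i ^ 2 ≤ 25 * r) : z ∈ latticeNet I r := by
  refine Finset.mem_filter.2 ⟨Fintype.mem_piFinset.2 fun i => ?_, hzr⟩
  split_ifs with hi
  · have h1 := (Finset.single_le_sum (f := fun i => z i ^ 2)
      (fun i _ => sq_nonneg _) (Finset.mem_univ i)).trans hzr
    have h2 : |z i| ≤ z i ^ 2 := by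
      rw [← Int.natCast_natAbs, ← Int.natAbs_sq]
      exact_mod_cast Nat.le_self_pow two_ne_zero _
    have h3 := abs_le.1 h2
    rw [Finset.mem_Icc]
    push_cast
    exact ⟨by linarith, by linarith⟩
  · simpa using hz i hi

/-- Each vector `z` of the net satisfies `1 ≤ 2 ^ (25 * r) * ∏ i, 2 ^ (-|z i|)`, and the sum of the
right-hand side over all integer vectors factorizes. -/
theorem card_latticeNet_le {n : ℕ} (I : Finset (Fin n)) (r : ℕ) (hI : I.card ≤ r) :
    ((latticeNet I r).card : ℝ) ≤ 2 ^ (27 * r) := by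
  have hw : ∀ z ∈ latticeNet I r, (1 : ℝ) ≤ 2 ^ (25 * r) * ∏ i, (1 / 2 : ℝ) ^ (z i).natAbs := by
    intro z hz
    have h1 := (Finset.mem_filter.1 hz).2
    have h2 : ∑ i, (z i).natAbs ≤ 25 * r := by
      zify
      refine (Finset.sum_le_sum fun i _ => ?_).trans h1
      rw [← Int.natCast_natAbs, ← Int.natAbs_sq]
      exact_mod_cast Nat.le_self_pow two_ne_zero _
    rw [Finset.prod_pow_eq_pow_sum, one_div, inv_pow, ← div_eq_mul_inv, one_le_div (by positivity)]
    exact pow_le_pow_right₀ (by norm_num) h2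
  calc ((latticeNet I r).card : ℝ) = ∑ z ∈ latticeNet I r, (1 : ℝ) := by simp
    _ ≤ ∑ z ∈ latticeNet I r, 2 ^ (25 * r) * ∏ i, (1 / 2 : ℝ) ^ (z i).natAbs :=
      Finset.sum_le_sum hw
    _ ≤ ∑ z ∈ Fintype.piFinset fun i => if i ∈ I then
          Finset.Icc (-((25 * r : ℕ) : ℤ)) ((25 * r : ℕ) : ℤ) else {0},
          2 ^ (25 * r) * ∏ i, (1 / 2 : ℝ) ^ (z i).natAbs :=
      Finset.sum_le_sum_of_subset_of_nonneg (Finset.filter_subset _ _) fun z _ _ => by positivity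
    _ = 2 ^ (25 * r) * ∏ i, ∑ z ∈ (if i ∈ I then
          Finset.Icc (-((25 * r : ℕ) : ℤ)) ((25 * r : ℕ) : ℤ) else {0}),
            (1 / 2 : ℝ) ^ z.natAbs := by
      rw [← Finset.mul_sum, Finset.prod_univ_sum]
    _ ≤ 2 ^ (25 * r) * ∏ i, (if i ∈ I then 4 else 1) := by
      refine mul_le_mul_of_nonneg_left (Finset.prod_le_prod
        (fun i _ => Finset.sum_nonneg fun z _ => by positivity) fun i _ => ?_) (by positivity)
      split_ifs
      · exact sum_half_pow_natAbs_le _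
      · simp
    _ = 2 ^ (25 * r) * 4 ^ I.card := by
      rw [Finset.prod_ite]
      simp
    _ ≤ 2 ^ (25 * r) * 4 ^ r := by
      gcongr
      norm_num
    _ = 2 ^ (27 * r) := by
      rw [show (4 : ℝ) = 2 ^ 2 by norm_num, ← pow_mul, ← pow_add]
      congr 1
      ring

theorem sqrt_div_mul_self_eq (k : ℕ) : √((k : ℝ) / 16 * k) = k / 4 := by
  rw [show (k : ℝ) / 16 * k = (k / 4) ^ 2 by ring, Real.sqrt_sq (by positivity)]

/-- A lower tail bound for `‖Sᵀ v‖ ^ 2`, which is `‖v‖ ^ 2` times a chi-squared variable with `k`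
degrees of freedom. -/
theorem measure_sum_sq_lt_le {n k : ℕ} (hk : 0 < k) (v : Fin n → ℝ) :
    (gaussianMatrix n k).real
      {S | ∑ a, (∑ i, v i * S i a) ^ 2 < k / 4 * ∑ i, v i ^ 2} ≤ 2 * Real.exp (-(k / 16)) := by
  have hM : (Matrix.vecMulVec v v).IsHermitian := by
    ext i j
    simp [Matrix.vecMulVec_apply, mul_comm]
  have hF : (0 : ℝ) ≤ ∑ i, v i ^ 2 := Finset.sum_nonneg fun _ _ => sq_nonneg _
  have htr : (Matrix.vecMulVec v v).trace = ∑ i, v i ^ 2 := by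
    simp [Matrix.trace, Matrix.vecMulVec_apply, sq]
  have hMF : ((Matrix.vecMulVec v v)ᵀ * Matrix.vecMulVec v v).trace ≤ (∑ i, v i ^ 2) ^ 2 := by
    apply le_of_eq
    simp only [Matrix.trace, Matrix.diag_apply, Matrix.mul_apply, Matrix.transpose_apply,
      Matrix.vecMulVec_apply]
    rw [sq, Finset.sum_mul_sum]
    exact Finset.sum_congr rfl fun i _ => Finset.sum_congr rfl fun j _ => by ring
  refine le_trans (measureReal_mono ?_)
    (measure_quadratic_form_gt_le (L := k / 16) hk hM hF hMF (by positivity) le_rfl)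
  intro S hS
  rw [Set.mem_ofPred_eq] at hS ⊢
  have hq : ((Matrix.of S)ᵀ * Matrix.vecMulVec v v * Matrix.of S).trace =
      ∑ a, (∑ i, v i * S i a) ^ 2 := by
    simp only [Matrix.mul_vecMulVec, Matrix.vecMulVec_mul]
    simp only [Matrix.trace, Matrix.diag_apply, Matrix.vecMulVec_apply, Matrix.mulVec,
      Matrix.vecMul, dotProduct, Matrix.transpose_apply, Matrix.of_apply, sq]
    simp only [mul_comm]
  rw [hq, htr, sqrt_div_mul_self_eq]
  refine lt_abs.2 (Or.inr ?_)
  linarith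

theorem measure_exists_lattice_le {n k : ℕ} (hk : 0 < k) (I : Finset (Fin n)) (r : ℕ)
    (hI : I.card ≤ r) :
    (gaussianMatrix n k).real
      {S | ∃ z ∈ latticeNet I r,
        ∑ a, (∑ i, (z i : ℝ) * S i a) ^ 2 < k / 4 * ∑ i, (z i : ℝ) ^ 2} ≤
      2 ^ (27 * r) * (2 * Real.exp (-(k / 16))) := by
  have hset : {S : Fin n → Fin k → ℝ | ∃ z ∈ latticeNet I r,
        ∑ a, (∑ i, (z i : ℝ) * S i a) ^ 2 < k / 4 * ∑ i, (z i : ℝ) ^ 2} =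
      ⋃ z ∈ latticeNet I r,
        {S | ∑ a, (∑ i, (z i : ℝ) * S i a) ^ 2 < k / 4 * ∑ i, (z i : ℝ) ^ 2} := by
    ext S
    simp
  rw [hset]
  refine (measureReal_biUnion_finset_le _ _).trans ?_
  refine (Finset.sum_le_sum fun z _ => measure_sum_sq_lt_le hk fun i => (z i : ℝ)).trans ?_
  rw [Finset.sum_const, nsmul_eq_mul]
  exact mul_le_mul_of_nonneg_right (card_latticeNet_le I r hI) (by positivity)

/-- A lower bound on the integer vectors of the net extends to all real vectors with support in `I`:
scaled to squared length `16 * r`, such a vector is rounded to an integer vector of squared length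
between `9 * r` and `25 * r`. -/
theorem lower_bound_of_lattice {n k r : ℕ} {I : Finset (Fin n)} (hI : I.card ≤ r)
    {S : Matrix (Fin n) (Fin k) ℝ}
    (hS : ∀ z ∈ latticeNet I r, k / 4 * ∑ i, (z i : ℝ) ^ 2 ≤ ∑ a, (∑ i, (z i : ℝ) * S i a) ^ 2)
    (hW : ∑ i ∈ I, ∑ a, S i a ^ 2 ≤ 2 * r * k) (y : Fin n → ℝ) (hy : ∀ i ∉ I, y i = 0) :
    k / 16 * ∑ i, y i ^ 2 ≤ ∑ a, (∑ i, y i * S i a) ^ 2 := by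
  set Y := ∑ i, y i ^ 2 with hY
  have hY0 : 0 ≤ Y := Finset.sum_nonneg fun _ _ => sq_nonneg _
  rcases hY0.eq_or_lt with h0 | h0
  · rw [← h0, mul_zero]
    exact Finset.sum_nonneg fun _ _ => sq_nonneg _
  have hr : 0 < r := by
    rcases Nat.eq_zero_or_pos r with hr | hr
    · exfalso
      have hI0 : I = ∅ := Finset.card_eq_zero.1 (by omega)
      refine h0.ne' (Finset.sum_eq_zero fun i _ => ?_)
      rw [hy i (by simp [hI0])]
      norm_num
    · exact hr
  have hr' : (0 : ℝ) < r := by exact_mod_cast hr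
  set c := √(16 * r / Y) with hc
  have hc2 : c ^ 2 = 16 * r / Y := Real.sq_sqrt (by positivity)
  have hc0 : 0 < c ^ 2 := by rw [hc2]; positivity
  obtain ⟨z, h1, h2, h3, h4⟩ := exists_rounding S (fun i => c * y i) I
  have h1' : ∀ i, ∃ m : ℤ, z i = m := fun i => by
    by_cases hi : i ∈ I
    · exact h1 i hi
    · exact ⟨0, by simp [h2 i hi, hy i hi]⟩
  choose m hm using h1'
  obtain rfl : z = fun i => (m i : ℝ) := funext hm
  have hz0 : ∀ i ∉ I, m i = 0 := fun i hi => by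
    have : (m i : ℝ) = c * y i := h2 i hi
    rw [hy i hi, mul_zero] at this
    exact_mod_cast this
  have hcy : ∑ i, (c * y i) ^ 2 = 16 * r := by
    simp_rw [mul_pow, ← Finset.mul_sum]
    rw [hc2, ← hY]
    field_simp
  have he : ∑ i, ((m i : ℝ) - c * y i) ^ 2 ≤ r := by
    calc ∑ i, ((m i : ℝ) - c * y i) ^ 2 ≤ ∑ i, if i ∈ I then (1 : ℝ) else 0 := by
          refine Finset.sum_le_sum fun i _ => ?_
          split_ifs with hi
          · exact h3 i
          · simp [hz0 i hi, hy i hi]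
      _ = I.card := by simp
      _ ≤ r := by exact_mod_cast hI
  have hlow : 9 * (r : ℝ) ≤ ∑ i, (m i : ℝ) ^ 2 := by
    have : ∑ i, (3 / 4 * (c * y i) ^ 2 - 3 * ((m i : ℝ) - c * y i) ^ 2) ≤ ∑ i, (m i : ℝ) ^ 2 :=
      Finset.sum_le_sum fun i _ => by
        nlinarith [sq_nonneg (2 * (m i : ℝ) - 3 / 2 * (c * y i))]
    rw [Finset.sum_sub_distrib, ← Finset.mul_sum, ← Finset.mul_sum, hcy] at this
    linarith
  have hup : ∑ i, (m i : ℝ) ^ 2 ≤ 25 * r := by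
    have : ∑ i, (m i : ℝ) ^ 2 ≤ ∑ i, (5 / 4 * (c * y i) ^ 2 + 5 * ((m i : ℝ) - c * y i) ^ 2) :=
      Finset.sum_le_sum fun i _ => by nlinarith [sq_nonneg (2 * (m i : ℝ) - 5 / 2 * (c * y i))]
    rw [Finset.sum_add_distrib, ← Finset.mul_sum, ← Finset.mul_sum, hcy] at this
    linarith
  have hmem := mem_latticeNet (r := r) hz0 (by exact_mod_cast hup)
  have hq := hS m hmem
  have hqc : ∑ a, (∑ i, c * y i * S i a) ^ 2 = c ^ 2 * ∑ a, (∑ i, y i * S i a) ^ 2 := by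
    simp_rw [mul_assoc, ← Finset.mul_sum, mul_pow, ← Finset.mul_sum]
  rw [hqc] at h4
  have hk0 : (0 : ℝ) ≤ k := Nat.cast_nonneg k
  have hcY : c ^ 2 * Y = 16 * r := by rw [hc2]; field_simp
  refine le_of_mul_le_mul_left ?_ hc0
  have : (k : ℝ) / 4 * (9 * r) ≤ k / 4 * ∑ i, (m i : ℝ) ^ 2 := by gcongr
  have h5 : c ^ 2 * (k / 16 * Y) = r * k := by linear_combination (k / 16 : ℝ) * hcY
  rw [h5]
  nlinarith [mul_nonneg hr'.le hk0]

/-! ### The range finder -/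

theorem mulVec_sq_le_of_projection {n : ℕ} {R : Matrix (Fin n) (Fin n) ℝ} (h1 : Rᵀ = R)
    (h2 : R * R = R) (v : Fin n → ℝ) : (R *ᵥ v) ⬝ᵥ (R *ᵥ v) ≤ v ⬝ᵥ v := by
  have h3 : v ⬝ᵥ (R *ᵥ v) = (R *ᵥ v) ⬝ᵥ (R *ᵥ v) := by
    conv_lhs => rw [← h2, ← Matrix.mulVec_mulVec, Matrix.dotProduct_mulVec,
      ← Matrix.mulVec_transpose, h1]
  have h4 : 0 ≤ (v - R *ᵥ v) ⬝ᵥ (v - R *ᵥ v) := by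
    rw [dotProduct]
    exact Finset.sum_nonneg fun i _ => mul_self_nonneg _
  rw [dotProduct_sub, sub_dotProduct, sub_dotProduct, dotProduct_comm (R *ᵥ v) v, h3] at h4
  linarith

theorem frobenius_mul_le_of_projection {n m : ℕ} {R : Matrix (Fin n) (Fin n) ℝ} (h1 : Rᵀ = R)
    (h2 : R * R = R) (X : Matrix (Fin n) (Fin m) ℝ) :
    ∑ i, ∑ j, (R * X) i j ^ 2 ≤ ∑ i, ∑ j, X i j ^ 2 := by
  rw [Finset.sum_comm]
  conv_rhs => rw [Finset.sum_comm]
  refine Finset.sum_le_sum fun j _ => ?_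
  have := mulVec_sq_le_of_projection h1 h2 fun i => X i j
  simpa [dotProduct, Matrix.mulVec, Matrix.mul_apply, sq] using this

/-- The deterministic core of the range finder, in the eigenbasis of `B = diagonal d`. As `R * B *
S` vanishes, the rows of `S` in `I`, combined with the coefficients from a column of `B * R`, cancel
those outside `I`. The former are bounded below by the conditioning of `S` on `I`, the latter above
by the Frobenius norm of the rest of `B * S`. -/
theorem frobenius_diagonal_mul_projection_le {n k : ℕ} (hk : 0 < k) {I : Finset (Fin n)}
    {S : Matrix (Fin n) (Fin k) ℝ} {d : Fin n → ℝ} {R : Matrix (Fin n) (Fin n) ℝ} (h1 : Rᵀ = R)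
    (h2 : R * R = R) (hR : R * Matrix.diagonal d * S = 0)
    (hlow : ∀ y : Fin n → ℝ, (∀ i ∉ I, y i = 0) →
      k / 16 * ∑ i, y i ^ 2 ≤ ∑ a, (∑ i, y i * S i a) ^ 2)
    (hup : ∑ i ∈ Iᶜ, d i ^ 2 * ∑ a, S i a ^ 2 ≤ 2 * k * ∑ i ∈ Iᶜ, d i ^ 2) :
    ∑ i, ∑ j, (Matrix.diagonal d * R) i j ^ 2 ≤ 33 * ∑ i ∈ Iᶜ, d i ^ 2 := by
  have hk' : (0 : ℝ) < k := by exact_mod_cast hk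
  have hsym : ∀ i j, R i j = R j i := fun i j => by
    conv_lhs => rw [← h1]
    rfl
  -- the part of `diagonal d * S` with rows outside `I`
  set X : Matrix (Fin n) (Fin k) ℝ := Matrix.of fun i a => if i ∈ I then 0 else d i * S i a with hX
  have hXF : ∑ i, ∑ a, X i a ^ 2 = ∑ i ∈ Iᶜ, d i ^ 2 * ∑ a, S i a ^ 2 := by
    rw [← Finset.sum_add_sum_compl I, Finset.sum_eq_zero, zero_add]
    · refine Finset.sum_congr rfl fun i hi => ?_
      rw [Finset.mul_sum]
      refine Finset.sum_congr rfl fun a _ => ?_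
      simp [hX, Finset.mem_compl.1 hi, mul_pow]
    · intro i hi
      simp [hX, hi]
  have hcancel : ∀ j a, ∑ i, (if i ∈ I then d i * R i j else 0) * S i a = -(R * X) j a := by
    intro j a
    have h0 := congrFun (congrFun hR j) a
    rw [Matrix.mul_apply] at h0
    simp only [Matrix.mul_diagonal, Matrix.zero_apply] at h0
    rw [Matrix.mul_apply, eq_neg_iff_add_eq_zero, ← Finset.sum_add_distrib]
    refine (Finset.sum_congr rfl fun i _ => ?_).trans h0
    by_cases hi : i ∈ I
    · simp only [hX, hi, hsym i j, if_true, Matrix.of_apply]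
      ring
    · simp only [hX, hi, if_false, Matrix.of_apply]
      ring
  -- the conditioning of `S` on `I`, applied to the columns of `diagonal d * R`
  have hin : k / 16 * ∑ j, ∑ i ∈ I, (d i * R i j) ^ 2 ≤ 2 * k * ∑ i ∈ Iᶜ, d i ^ 2 := by
    calc k / 16 * ∑ j, ∑ i ∈ I, (d i * R i j) ^ 2
        = ∑ j, k / 16 * ∑ i, (if i ∈ I then d i * R i j else 0) ^ 2 := by
          rw [Finset.mul_sum]
          refine Finset.sum_congr rfl fun j _ => ?_
          simp [ite_pow, Finset.sum_ite_mem]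
      _ ≤ ∑ j, ∑ a, (∑ i, (if i ∈ I then d i * R i j else 0) * S i a) ^ 2 :=
          Finset.sum_le_sum fun j _ => hlow _ fun i hi => by simp [hi]
      _ = ∑ j, ∑ a, (R * X) j a ^ 2 := by simp_rw [hcancel, neg_sq]
      _ ≤ ∑ j, ∑ a, X j a ^ 2 := frobenius_mul_le_of_projection h1 h2 X
      _ ≤ _ := by rw [hXF]; exact hup
  have hrow : ∀ i, ∑ j, R i j ^ 2 ≤ 1 := fun i => by
    have := mulVec_sq_le_of_projection h1 h2 (Pi.single i 1)
    simpa [dotProduct, sq, hsym i, Pi.single_apply, Matrix.col_apply] using this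
  have hout : ∑ j, ∑ i ∈ Iᶜ, (d i * R i j) ^ 2 ≤ ∑ i ∈ Iᶜ, d i ^ 2 := by
    rw [Finset.sum_comm]
    refine Finset.sum_le_sum fun i _ => ?_
    simp_rw [mul_pow, ← Finset.mul_sum]
    exact mul_le_of_le_one_right (sq_nonneg _) (hrow i)
  have hsplit : ∑ i, ∑ j, (Matrix.diagonal d * R) i j ^ 2 =
      ∑ j, ∑ i ∈ I, (d i * R i j) ^ 2 + ∑ j, ∑ i ∈ Iᶜ, (d i * R i j) ^ 2 := by
    rw [← Finset.sum_add_distrib, Finset.sum_comm]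
    refine Finset.sum_congr rfl fun j _ => ?_
    simp only [Finset.sum_add_sum_compl, Matrix.diagonal_mul]
  rw [hsplit]
  have h6 : ∑ j, ∑ i ∈ I, (d i * R i j) ^ 2 ≤ 32 * ∑ i ∈ Iᶜ, d i ^ 2 := by
    refine le_of_mul_le_mul_left (hin.trans (le_of_eq ?_)) (show (0 : ℝ) < k / 16 by positivity)
    ring
  linarith

theorem measure_weighted_sq_gt_two_le {n k : ℕ} (hk : 0 < k) (w : Fin n → ℝ)
    (hw : ∀ i, 0 ≤ w i) :
    (gaussianMatrix n k).real {S | 2 * k * ∑ i, w i < ∑ i, w i * ∑ a, S i a ^ 2} ≤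
      2 * Real.exp (-(k / 16)) := by
  have hF : 0 ≤ ∑ i, w i := Finset.sum_nonneg fun i _ => hw i
  have hw2 : ∑ i, w i ^ 2 ≤ (∑ i, w i) ^ 2 := Finset.sum_sq_le_sq_sum_of_nonneg fun i _ => hw i
  refine le_trans (measureReal_mono ?_)
    (measure_abs_weighted_sq_gt_le (L := k / 16) hk w hF hw2 (by positivity) le_rfl)
  intro S hS
  rw [Set.mem_ofPred_eq] at hS ⊢
  have h : ∑ i, w i * ∑ a, (S i a ^ 2 - 1) = ∑ i, w i * ∑ a, S i a ^ 2 - k * ∑ i, w i := by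
    rw [Finset.mul_sum, ← Finset.sum_sub_distrib]
    refine Finset.sum_congr rfl fun i _ => ?_
    simp [Finset.sum_sub_distrib]
    ring
  rw [h, sqrt_div_mul_self_eq]
  refine lt_abs.2 (Or.inl ?_)
  have : (0 : ℝ) ≤ k * ∑ i, w i := by positivity
  linarith

theorem trace_transpose_mul_self {n m : ℕ} (M : Matrix (Fin n) (Fin m) ℝ) :
    (Mᵀ * M).trace = ∑ i, ∑ j, M i j ^ 2 := by
  rw [Finset.sum_comm]
  refine Finset.sum_congr rfl fun j _ => ?_
  rw [Matrix.diag_apply, Matrix.mul_apply]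
  exact Finset.sum_congr rfl fun i _ => by rw [Matrix.transpose_apply, sq]

theorem frobenius_conj_orthogonal {n : ℕ} {U : Matrix (Fin n) (Fin n) ℝ} (hU : U * Uᵀ = 1)
    (X : Matrix (Fin n) (Fin n) ℝ) :
    ∑ i, ∑ j, (Uᵀ * X * U) i j ^ 2 = ∑ i, ∑ j, X i j ^ 2 := by
  rw [← trace_transpose_mul_self, ← trace_transpose_mul_self,
    show (Uᵀ * X * U)ᵀ * (Uᵀ * X * U) = Uᵀ * (Xᵀ * (U * Uᵀ) * X * U) by
      simp only [Matrix.transpose_mul, Matrix.transpose_transpose, Matrix.mul_assoc],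
    Matrix.trace_mul_comm, hU, Matrix.mul_one, Matrix.mul_assoc, hU, Matrix.mul_one]

/-- With high probability, every projection `R` that annihilates the range of `B * S` leaves of `B`
little more than the eigenvalues outside `I`. The set need not be measurable: its outer measure is
bounded through a set in the eigenbasis. -/
theorem measure_range_finder_le {n k : ℕ} (hk : 0 < k) {B U : Matrix (Fin n) (Fin n) ℝ}
    {d : Fin n → ℝ} (h1 : U * Uᵀ = 1) (h2 : Uᵀ * U = 1) (hB : B = Uᵀ * Matrix.diagonal d * U)
    (I : Finset (Fin n)) {r : ℕ} (hI : I.card ≤ r) :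
    (gaussianMatrix n k).real
      {S | ∃ R : Matrix (Fin n) (Fin n) ℝ, Rᵀ = R ∧ R * R = R ∧ R * B * Matrix.of S = 0 ∧
        33 * ∑ i ∈ Iᶜ, d i ^ 2 < ∑ i, ∑ j, (R * B * R) i j ^ 2} ≤
      (2 ^ (27 * r) + 2) * (2 * Real.exp (-(k / 16))) := by
  have hk' : (0 : ℝ) < k := by exact_mod_cast hk
  -- in the eigenbasis, the three events on the Gaussian matrix `U * S` that are to be avoided
  set E1 : Set (Fin n → Fin k → ℝ) := {S | ∃ z ∈ latticeNet I r,
    ∑ a, (∑ i, (z i : ℝ) * S i a) ^ 2 < k / 4 * ∑ i, (z i : ℝ) ^ 2} with hE1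
  set w2 : Fin n → ℝ := fun i => if i ∈ I then 1 else 0 with hw2
  set w3 : Fin n → ℝ := fun i => if i ∈ I then 0 else d i ^ 2 with hw3
  set E2 : Set (Fin n → Fin k → ℝ) := {S | 2 * k * ∑ i, w2 i < ∑ i, w2 i * ∑ a, S i a ^ 2} with hE2
  set E3 : Set (Fin n → Fin k → ℝ) := {S | 2 * k * ∑ i, w3 i < ∑ i, w3 i * ∑ a, S i a ^ 2} with hE3
  have m1 := measure_exists_lattice_le hk I r hI
  have m2 := measure_weighted_sq_gt_two_le hk w2 fun i => by simp only [hw2]; split_ifs <;> simp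
  have m3 := measure_weighted_sq_gt_two_le hk w3 fun i => by
    simp only [hw3]; split_ifs <;> positivity
  have s2 : ∀ f : Fin n → ℝ, ∑ i, w2 i * f i = ∑ i ∈ I, f i := fun f => by
    simp [hw2, Finset.sum_ite_mem]
  have s3 : ∀ f : Fin n → ℝ, ∑ i, w3 i * f i = ∑ i ∈ Iᶜ, d i ^ 2 * f i := fun f => by
    rw [← Finset.sum_add_sum_compl I, Finset.sum_eq_zero, zero_add]
    · exact Finset.sum_congr rfl fun i hi => by simp [hw3, Finset.mem_compl.1 hi]
    · intro i hi
      simp [hw3, hi]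
  have hT : AEMeasurable (fun (S : Fin n → Fin k → ℝ) i a => ∑ j, U i j * S j a)
      (gaussianMatrix n k) := by
    refine Measurable.aemeasurable ?_
    fun_prop
  have hE : (gaussianMatrix n k).real (E1 ∪ E2 ∪ E3) ≤
      (2 ^ (27 * r) + 2) * (2 * Real.exp (-(k / 16))) := by
    refine (measureReal_union_le _ _).trans ?_
    have := measureReal_union_le (μ := gaussianMatrix n k) E1 E2
    linarith
  refine le_trans ?_ hE
  have hle : (gaussianMatrix n k).real
      ((fun (S : Fin n → Fin k → ℝ) i a => ∑ j, U i j * S j a) ⁻¹' (E1 ∪ E2 ∪ E3)) ≤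
      (gaussianMatrix n k).real (E1 ∪ E2 ∪ E3) := by
    have := Measure.le_map_apply hT (E1 ∪ E2 ∪ E3)
    rw [map_mul_gaussianMatrix U h1] at this
    exact ENNReal.toReal_mono (measure_ne_top _ _) this
  refine le_trans (measureReal_mono ?_) hle
  rintro S ⟨R, r1, r2, r3, r4⟩
  by_contra hS
  simp only [Set.mem_preimage, Set.mem_union, not_or] at hS
  obtain ⟨⟨g1, g2⟩, g3⟩ := hS
  have hUS : (fun i a => ∑ j, U i j * S j a) = U * Matrix.of S := by
    ext i a
    simp [Matrix.mul_apply]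
  set S' : Matrix (Fin n) (Fin k) ℝ := U * Matrix.of S with hS'
  have f1 : ∀ z ∈ latticeNet I r,
      k / 4 * ∑ i, (z i : ℝ) ^ 2 ≤ ∑ a, (∑ i, (z i : ℝ) * S' i a) ^ 2 := by
    rw [← hUS]
    exact fun z hz => not_lt.1 fun hlt => g1 ⟨z, hz, hlt⟩
  have f2 : ∑ i ∈ I, ∑ a, S' i a ^ 2 ≤ 2 * k * ∑ i, w2 i := by
    rw [← hUS, ← s2]
    exact not_lt.1 g2
  have f3 : ∑ i ∈ Iᶜ, d i ^ 2 * ∑ a, S' i a ^ 2 ≤ 2 * k * ∑ i, w3 i := by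
    rw [← hUS, ← s3]
    exact not_lt.1 g3
  have e2 : ∑ i, w2 i = I.card := by simp [hw2]
  have e3 : ∑ i, w3 i = ∑ i ∈ Iᶜ, d i ^ 2 := by simpa using s3 fun _ => 1
  rw [e2] at f2
  rw [e3] at f3
  have hIr : (I.card : ℝ) ≤ r := by exact_mod_cast hI
  have hlow := lower_bound_of_lattice hI f1 (f2.trans (by nlinarith))
  set R' := U * R * Uᵀ with hR'
  have q1 : R'ᵀ = R' := by
    simp only [hR', Matrix.transpose_mul, Matrix.transpose_transpose, r1, Matrix.mul_assoc]
  have q2 : R' * R' = R' := by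
    calc R' * R' = U * (R * (Uᵀ * U) * R) * Uᵀ := by simp only [hR', Matrix.mul_assoc]
      _ = R' := by rw [h2, Matrix.mul_one, r2]
  have q3 : R' * Matrix.diagonal d * S' = 0 := by
    calc R' * Matrix.diagonal d * S' = U * (R * (Uᵀ * Matrix.diagonal d * U) * Matrix.of S) := by
          simp only [hR', hS', Matrix.mul_assoc]
      _ = 0 := by rw [← hB, r3, Matrix.mul_zero]
  have hfin := frobenius_diagonal_mul_projection_le hk q1 q2 q3 hlow f3
  have hRBR : R * B * R = Uᵀ * (R' * (Matrix.diagonal d * R')) * U := by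
    rw [hB]
    calc R * (Uᵀ * Matrix.diagonal d * U) * R
        = (1 * R * (Uᵀ * Matrix.diagonal d * U) * R * 1) := by simp
      _ = (Uᵀ * U) * R * (Uᵀ * Matrix.diagonal d * U) * R * (Uᵀ * U) := by rw [h2]
      _ = _ := by simp only [hR', Matrix.mul_assoc]
  rw [hRBR, frobenius_conj_orthogonal h1] at r4
  exact absurd r4 (not_lt.2 ((frobenius_mul_le_of_projection q1 q2 _).trans hfin))

/-! ### The complementary projection -/

/-- The orthogonal projection `1 - Q * Qᵀ` onto the complement of the column span of `Y`, where `Q`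
is the orthonormal basis of the column span returned by `orth`. -/
noncomputable def complProj {n k : ℕ}
    (orth : Matrix (Fin n) (Fin k) ℝ → Σ q : ℕ, Matrix (Fin n) (Fin q) ℝ)
    (Y : Matrix (Fin n) (Fin k) ℝ) : Matrix (Fin n) (Fin n) ℝ :=
  1 - (orth Y).2 * (orth Y).2ᵀ

section complProj

variable {n k : ℕ} {orth : Matrix (Fin n) (Fin k) ℝ → Σ q : ℕ, Matrix (Fin n) (Fin q) ℝ}

theorem complProj_transpose (Y : Matrix (Fin n) (Fin k) ℝ) :
    (complProj orth Y)ᵀ = complProj orth Y := by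
  simp [complProj]

theorem complProj_mul_self (h : IsOrthonormalization orth) (Y : Matrix (Fin n) (Fin k) ℝ) :
    complProj orth Y * complProj orth Y = complProj orth Y := by
  have h1 : (orth Y).2 * (orth Y).2ᵀ * ((orth Y).2 * (orth Y).2ᵀ) = (orth Y).2 * (orth Y).2ᵀ := by
    calc (orth Y).2 * (orth Y).2ᵀ * ((orth Y).2 * (orth Y).2ᵀ)
        = (orth Y).2 * ((orth Y).2ᵀ * (orth Y).2) * (orth Y).2ᵀ := by
          simp only [Matrix.mul_assoc]
      _ = _ := by rw [(h Y).1, Matrix.mul_one]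
  simp [complProj, mul_sub, sub_mul, h1]

theorem complProj_mulVec_mulVec (h : IsOrthonormalization orth) (Y : Matrix (Fin n) (Fin k) ℝ)
    (c : Fin k → ℝ) : complProj orth Y *ᵥ (Y *ᵥ c) = 0 := by
  have h1 : Y *ᵥ c ∈ LinearMap.range (orth Y).2.mulVecLin := by
    rw [(h Y).2]
    exact ⟨c, rfl⟩
  obtain ⟨b, hb⟩ := h1
  rw [← hb, Matrix.mulVecLin_apply, complProj, Matrix.mulVec_mulVec, Matrix.sub_mul,
    Matrix.mul_assoc, (h Y).1]
  simp

theorem complProj_mul (h : IsOrthonormalization orth) (Y : Matrix (Fin n) (Fin k) ℝ) :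
    complProj orth Y * Y = 0 := by
  refine Matrix.ext_of_mulVec_single fun i => ?_
  rw [← Matrix.mulVec_mulVec, complProj_mulVec_mulVec h, Matrix.zero_mulVec]

theorem exists_sub_complProj_mulVec (h : IsOrthonormalization orth) (Y : Matrix (Fin n) (Fin k) ℝ)
    (v : Fin n → ℝ) : ∃ c, v - Y *ᵥ c = complProj orth Y *ᵥ v := by
  have h1 : (orth Y).2 *ᵥ ((orth Y).2ᵀ *ᵥ v) ∈ LinearMap.range Y.mulVecLin := by
    rw [← (h Y).2]
    exact ⟨_, rfl⟩
  obtain ⟨c, hc⟩ := h1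
  refine ⟨c, ?_⟩
  rw [Matrix.mulVecLin_apply] at hc
  rw [hc, complProj, Matrix.sub_mulVec, Matrix.one_mulVec, Matrix.mulVec_mulVec]

theorem dotProduct_complProj_mulVec (h : IsOrthonormalization orth)
    (Y : Matrix (Fin n) (Fin k) ℝ) (v : Fin n → ℝ) :
    v ⬝ᵥ (complProj orth Y *ᵥ v) = (complProj orth Y *ᵥ v) ⬝ᵥ (complProj orth Y *ᵥ v) := by
  conv_lhs => rw [← complProj_mul_self h, ← Matrix.mulVec_mulVec, Matrix.dotProduct_mulVec,
    ← Matrix.mulVec_transpose, complProj_transpose]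

theorem dotProduct_complProj_le (h : IsOrthonormalization orth)
    (Y : Matrix (Fin n) (Fin k) ℝ) (v : Fin n → ℝ) (c : Fin k → ℝ) :
    v ⬝ᵥ (complProj orth Y *ᵥ v) ≤ (v - Y *ᵥ c) ⬝ᵥ (v - Y *ᵥ c) := by
  have := mulVec_sq_le_of_projection (complProj_transpose (orth := orth) Y)
    (complProj_mul_self h Y) (v - Y *ᵥ c)
  rwa [Matrix.mulVec_sub, complProj_mulVec_mulVec h, sub_zero,
    ← dotProduct_complProj_mulVec h] at this

/-- The routine `orth` need not be measurable, but the projection depends on the column span only: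
its quadratic form is a squared distance, hence an infimum over countably many coefficient
vectors. -/
theorem measurable_dotProduct_complProj (h : IsOrthonormalization orth)
    (B : Matrix (Fin n) (Fin n) ℝ) (v : Fin n → ℝ) :
    Measurable fun S : Fin n → Fin k → ℝ =>
      v ⬝ᵥ (complProj orth (B * Matrix.of S) *ᵥ v) := by
  refine measurable_of_Iio fun a => ?_
  have hset : (fun S : Fin n → Fin k → ℝ => v ⬝ᵥ (complProj orth (B * Matrix.of S) *ᵥ v)) ⁻¹'
      Set.Iio a = ⋃ m : ℕ, {S : Fin n → Fin k → ℝ |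
        (v - (B * Matrix.of S) *ᵥ TopologicalSpace.denseSeq (Fin k → ℝ) m) ⬝ᵥ
          (v - (B * Matrix.of S) *ᵥ TopologicalSpace.denseSeq (Fin k → ℝ) m) < a} := by
    ext S
    simp only [Set.mem_preimage, Set.mem_Iio, Set.mem_iUnion, Set.mem_ofPred_eq]
    constructor
    · intro hS
      obtain ⟨c, hc⟩ := exists_sub_complProj_mulVec h (B * Matrix.of S) v
      have hopen : IsOpen {c : Fin k → ℝ |
          (v - (B * Matrix.of S) *ᵥ c) ⬝ᵥ (v - (B * Matrix.of S) *ᵥ c) < a} := by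
        refine isOpen_lt ?_ continuous_const
        simp only [dotProduct, Pi.sub_apply, Matrix.mulVec]
        fun_prop
      obtain ⟨m, hm⟩ := (TopologicalSpace.denseRange_denseSeq (Fin k → ℝ)).exists_mem_open hopen
        ⟨c, by rw [Set.mem_ofPred_eq, hc, ← dotProduct_complProj_mulVec h]; exact hS⟩
      exact ⟨m, hm⟩
    · rintro ⟨m, hm⟩
      exact (dotProduct_complProj_le h _ v _).trans_lt hm
  rw [hset]
  refine MeasurableSet.iUnion fun m => measurableSet_lt ?_ measurable_const
  simp only [dotProduct, Pi.sub_apply, Matrix.mulVec, Matrix.mul_apply, Matrix.of_apply]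
  fun_prop

theorem measurable_complProj_apply (h : IsOrthonormalization orth)
    (B : Matrix (Fin n) (Fin n) ℝ) (i j : Fin n) :
    Measurable fun S : Fin n → Fin k → ℝ => complProj orth (B * Matrix.of S) i j := by
  have hpol : ∀ Y, complProj orth Y i j =
      1 / 2 * ((Pi.single i 1 + Pi.single j 1) ⬝ᵥ
        (complProj orth Y *ᵥ (Pi.single i 1 + Pi.single j 1)) -
        Pi.single i 1 ⬝ᵥ (complProj orth Y *ᵥ Pi.single i 1) -
        Pi.single j 1 ⬝ᵥ (complProj orth Y *ᵥ Pi.single j 1)) := by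
    intro Y
    have hs : complProj orth Y j i = complProj orth Y i j := by
      conv_lhs => rw [← complProj_transpose]
      rfl
    simp only [Matrix.mulVec_add, add_dotProduct, dotProduct_add, single_one_dotProduct,
      Matrix.mulVec_single_one, Matrix.col_apply, hs]
    ring
  simp_rw [hpol]
  exact ((((measurable_dotProduct_complProj h B _).sub (measurable_dotProduct_complProj h B _)).sub
    (measurable_dotProduct_complProj h B _)).const_mul _)

end complProj

/-! ### The error of Hutch++ -/

theorem output_hutchPP_sub_trace {n s : ℕ}
    {orth : Matrix (Fin n) (Fin (s / 4)) ℝ → Σ q : ℕ, Matrix (Fin n) (Fin q) ℝ}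
    (h : IsOrthonormalization orth) (hs : 2 ∣ s) (hs0 : 0 < s)
    (S : Matrix (Fin n) (Fin (s / 4)) ℝ) (G : Matrix (Fin n) (Fin (s / 2)) ℝ)
    (B : Matrix (Fin n) (Fin n) ℝ) :
    (hutchPP s orth S G).output B - B.trace =
      ((Gᵀ * (complProj orth (B * S) * B * complProj orth (B * S)) * G).trace -
        (s / 2 : ℕ) * (complProj orth (B * S) * B * complProj orth (B * S)).trace) /
          (s / 2 : ℕ) := by
  have hs' : (0 : ℝ) < s := by exact_mod_cast hs0
  rw [output_hutchPP]
  change _ + 2 / (s : ℝ) * (Gᵀ * complProj orth (B * S) * B * complProj orth (B * S) * G).trace -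
    _ = _
  have h1 : ((orth (B * S)).2ᵀ * B * (orth (B * S)).2).trace - B.trace =
      -(complProj orth (B * S) * B * complProj orth (B * S)).trace := by
    rw [Matrix.trace_mul_comm (complProj orth (B * S) * B), ← Matrix.mul_assoc,
      complProj_mul_self h, complProj, Matrix.sub_mul, Matrix.one_mul, Matrix.trace_sub,
      Matrix.mul_assoc (orth (B * S)).2, Matrix.trace_mul_comm (orth (B * S)).2]
    ring
  rw [Nat.cast_div hs (by norm_num)]
  simp only [Matrix.mul_assoc] at h1 ⊢
  rw [add_sub_right_comm, h1]
  push_cast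
  field_simp
  ring

theorem measurableSet_hutchinson_deviation {n k m : ℕ}
    {orth : Matrix (Fin n) (Fin k) ℝ → Σ q : ℕ, Matrix (Fin n) (Fin q) ℝ}
    (h : IsOrthonormalization orth) (B : Matrix (Fin n) (Fin n) ℝ) (c : ℝ) :
    MeasurableSet {ω : (Fin n → Fin k → ℝ) × (Fin n → Fin m → ℝ) |
      3 * √(∑ i, ∑ j, (complProj orth (B * Matrix.of ω.1) * B *
        complProj orth (B * Matrix.of ω.1)) i j ^ 2) * c <
      |((Matrix.of ω.2)ᵀ * (complProj orth (B * Matrix.of ω.1) * B *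
        complProj orth (B * Matrix.of ω.1)) * Matrix.of ω.2).trace -
        m * (complProj orth (B * Matrix.of ω.1) * B *
          complProj orth (B * Matrix.of ω.1)).trace|} := by
  have hR : ∀ i j, Measurable fun ω : (Fin n → Fin k → ℝ) × (Fin n → Fin m → ℝ) =>
      (complProj orth (B * Matrix.of ω.1)) i j :=
    fun i j => (measurable_complProj_apply h B i j).comp measurable_fst
  have hM : ∀ i j, Measurable fun ω : (Fin n → Fin k → ℝ) × (Fin n → Fin m → ℝ) =>
      (complProj orth (B * Matrix.of ω.1) * B * complProj orth (B * Matrix.of ω.1)) i j := by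
    intro i j
    simp only [Matrix.mul_apply]
    exact Finset.measurable_fun_sum _ fun a _ => (Finset.measurable_fun_sum _ fun b _ =>
      (hR i b).mul_const _).mul (hR a j)
  have htr : Measurable fun ω : (Fin n → Fin k → ℝ) × (Fin n → Fin m → ℝ) =>
      (complProj orth (B * Matrix.of ω.1) * B * complProj orth (B * Matrix.of ω.1)).trace :=
    Finset.measurable_fun_sum _ fun i _ => hM i i
  have hF : Measurable fun ω : (Fin n → Fin k → ℝ) × (Fin n → Fin m → ℝ) =>
      ∑ i, ∑ j, (complProj orth (B * Matrix.of ω.1) * B *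
        complProj orth (B * Matrix.of ω.1)) i j ^ 2 :=
    Finset.measurable_fun_sum _ fun i _ => Finset.measurable_fun_sum _ fun j _ =>
      (hM i j).pow_const 2
  have hG : ∀ i a, Measurable fun ω : (Fin n → Fin k → ℝ) × (Fin n → Fin m → ℝ) => ω.2 i a :=
    fun i a => by fun_prop
  have hq : Measurable fun ω : (Fin n → Fin k → ℝ) × (Fin n → Fin m → ℝ) =>
      ((Matrix.of ω.2)ᵀ * (complProj orth (B * Matrix.of ω.1) * B *
        complProj orth (B * Matrix.of ω.1)) * Matrix.of ω.2).trace := by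
    have : ∀ (X : Matrix (Fin n) (Fin n) ℝ) (G : Matrix (Fin n) (Fin m) ℝ),
        (Gᵀ * X * G).trace = ∑ a, ∑ j, (∑ i, G i a * X i j) * G j a := fun X G => by
      refine Finset.sum_congr rfl fun a _ => ?_
      rw [Matrix.diag_apply, Matrix.mul_apply]
      refine Finset.sum_congr rfl fun j _ => ?_
      rw [Matrix.mul_apply]
      rfl
    simp only [this, Matrix.of_apply]
    exact Finset.measurable_fun_sum _ fun a _ => Finset.measurable_fun_sum _ fun j _ =>
      (Finset.measurable_fun_sum _ fun i _ => (hG i a).mul (hM i j)).mul (hG j a)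
  exact measurableSet_lt ((hF.sqrt.const_mul 3).mul_const c) (hq.sub (htr.const_mul _)).abs

/-- The sketch `S` fixes the matrix `R * B * R` to which the estimator with the independent sketch
`G` is applied, so that the two failure probabilities add up by Fubini. -/
theorem measure_hutchPP_error_le {n s : ℕ}
    {orth : Matrix (Fin n) (Fin (s / 4)) ℝ → Σ q : ℕ, Matrix (Fin n) (Fin q) ℝ}
    (h : IsOrthonormalization orth) (hs : 2 ∣ s) (hs0 : 0 < s / 4)
    {B U : Matrix (Fin n) (Fin n) ℝ}
    {d : Fin n → ℝ} (h1 : U * Uᵀ = 1) (h2 : Uᵀ * U = 1) (hB : B = Uᵀ * Matrix.diagonal d * U)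
    (I : Finset (Fin n)) {r : ℕ} (hI : I.card ≤ r) {L : ℝ} (hL0 : 0 ≤ L)
    (hL : L ≤ (s / 2 : ℕ) / 16) :
    ((gaussianMatrix n (s / 4)).prod (gaussianMatrix n (s / 2))).real
      {ω | 3 * √(33 * ∑ i ∈ Iᶜ, d i ^ 2) * √(L * (s / 2 : ℕ)) / (s / 2 : ℕ) <
        |(hutchPP s orth (Matrix.of ω.1) (Matrix.of ω.2)).output B - B.trace|} ≤
      (2 ^ (27 * r) + 2) * (2 * Real.exp (-((s / 4 : ℕ) / 16))) + 2 * Real.exp (-L) := by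
  have hm : 0 < s / 2 := by omega
  have hm' : (0 : ℝ) < (s / 2 : ℕ) := by exact_mod_cast hm
  have hsym : B.IsHermitian := by
    rw [Matrix.IsHermitian, Matrix.conjTranspose_eq_transpose_of_trivial, hB]
    simp [Matrix.mul_assoc]
  set M : (Fin n → Fin (s / 4) → ℝ) → Matrix (Fin n) (Fin n) ℝ := fun S =>
    complProj orth (B * Matrix.of S) * B * complProj orth (B * Matrix.of S) with hM
  set E1 : Set (Fin n → Fin (s / 4) → ℝ) := {S | ∃ R : Matrix (Fin n) (Fin n) ℝ, Rᵀ = R ∧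
    R * R = R ∧ R * B * Matrix.of S = 0 ∧
      33 * ∑ i ∈ Iᶜ, d i ^ 2 < ∑ i, ∑ j, (R * B * R) i j ^ 2} with hE1
  set E2 : Set ((Fin n → Fin (s / 4) → ℝ) × (Fin n → Fin (s / 2) → ℝ)) := {ω |
    3 * √(∑ i, ∑ j, M ω.1 i j ^ 2) * √(L * (s / 2 : ℕ)) <
      |((Matrix.of ω.2)ᵀ * M ω.1 * Matrix.of ω.2).trace - (s / 2 : ℕ) * (M ω.1).trace|} with hE2
  have hE1m := measure_range_finder_le hs0 h1 h2 hB I hI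
  have hE2m : ((gaussianMatrix n (s / 4)).prod (gaussianMatrix n (s / 2))).real E2 ≤
      2 * Real.exp (-L) := by
    have hmeas : MeasurableSet E2 := measurableSet_hutchinson_deviation h B _
    refine ENNReal.toReal_le_of_le_ofReal (by positivity) ?_
    rw [Measure.prod_apply hmeas]
    calc _ ≤ ∫⁻ _, ENNReal.ofReal (2 * Real.exp (-L)) ∂gaussianMatrix n (s / 4) := by
          refine lintegral_mono fun S => ?_
          have hMS : (M S).IsHermitian := by
            rw [Matrix.IsHermitian, Matrix.conjTranspose_eq_transpose_of_trivial] at hsym ⊢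
            simp only [hM, Matrix.transpose_mul, complProj_transpose, hsym, Matrix.mul_assoc]
          have := measure_quadratic_form_gt_le hm hMS
            (Real.sqrt_nonneg (∑ i, ∑ j, M S i j ^ 2))
            (by rw [trace_transpose_mul_self, Real.sq_sqrt (by positivity)]) hL0 hL
          rw [measureReal_def] at this
          exact (ENNReal.le_ofReal_iff_toReal_le (measure_ne_top _ _) (by positivity)).2 this
      _ = ENNReal.ofReal (2 * Real.exp (-L)) := by simp
  have hsub : {ω : (Fin n → Fin (s / 4) → ℝ) × (Fin n → Fin (s / 2) → ℝ) |
      3 * √(33 * ∑ i ∈ Iᶜ, d i ^ 2) * √(L * (s / 2 : ℕ)) / (s / 2 : ℕ) <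
        |(hutchPP s orth (Matrix.of ω.1) (Matrix.of ω.2)).output B - B.trace|} ⊆
      E1 ×ˢ Set.univ ∪ E2 := by
    rintro ⟨S, G⟩ hω
    by_contra hcon
    rw [Set.mem_union, not_or] at hcon
    obtain ⟨c1, c2⟩ := hcon
    have c1' : ∑ i, ∑ j, M S i j ^ 2 ≤ 33 * ∑ i ∈ Iᶜ, d i ^ 2 := by
      refine not_lt.1 fun hlt => c1 ⟨⟨complProj orth (B * Matrix.of S), complProj_transpose _,
        complProj_mul_self h _, ?_, hlt⟩, trivial⟩
      rw [Matrix.mul_assoc, complProj_mul h]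
    have c2' : |((Matrix.of G)ᵀ * M S * Matrix.of G).trace - (s / 2 : ℕ) * (M S).trace| ≤
        3 * √(∑ i, ∑ j, M S i j ^ 2) * √(L * (s / 2 : ℕ)) := not_lt.1 fun hlt => c2 hlt
    rw [Set.mem_ofPred_eq, output_hutchPP_sub_trace h hs (by omega), abs_div,
      abs_of_pos hm'] at hω
    refine absurd hω (not_lt.2 ?_)
    gcongr
    refine c2'.trans ?_
    gcongr
  refine (measureReal_mono hsub).trans ((measureReal_union_le _ _).trans (add_le_add ?_ hE2m))
  rw [measureReal_prod_prod, probReal_univ, mul_one]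
  exact hE1m

/-! ### The spectral tail and the entropy -/

/-- Apart from `i₀`, fewer than `r` entries exceed the `r`-th part of the sum `T` of the others. Off
these entries, the squares add up to at most `T ^ 2 / r`. -/
theorem exists_large_indices {n : ℕ} (d : Fin n → ℝ) (hd : ∀ i, 0 ≤ d i) (i₀ : Fin n) {r : ℕ}
    (hr : 0 < r) : ∃ I : Finset (Fin n), I.card ≤ r ∧
      r * ∑ i ∈ Iᶜ, d i ^ 2 ≤ (∑ i ∈ {i₀}ᶜ, d i) ^ 2 := by
  set T := ∑ i ∈ {i₀}ᶜ, d i with hT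
  have hT0 : 0 ≤ T := Finset.sum_nonneg fun i _ => hd i
  have hr' : (0 : ℝ) < r := by exact_mod_cast hr
  set J := ({i₀}ᶜ : Finset (Fin n)).filter fun i => T < r * d i with hJ
  have hcard : J.card < r := by
    rcases J.eq_empty_or_nonempty with h | h
    · simpa [h] using hr
    · have h1 : ∑ i ∈ J, T < ∑ i ∈ J, r * d i :=
        Finset.sum_lt_sum_of_nonempty h fun i hi => (Finset.mem_filter.1 hi).2
      have h2 : ∑ i ∈ J, d i ≤ T :=
        Finset.sum_le_sum_of_subset_of_nonneg (Finset.filter_subset _ _) fun i _ _ => hd i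
      rw [Finset.sum_const, nsmul_eq_mul, ← Finset.mul_sum] at h1
      have h3 : (J.card : ℝ) * T < r * T := h1.trans_le (by gcongr)
      exact_mod_cast lt_of_mul_lt_mul_right h3 hT0
  refine ⟨insert i₀ J, (Finset.card_insert_le _ _).trans hcard, ?_⟩
  have hmem : ∀ i ∈ (insert i₀ J)ᶜ, i ∈ ({i₀}ᶜ : Finset (Fin n)) ∧ r * d i ≤ T := by
    intro i hi
    rw [Finset.mem_compl, Finset.mem_insert, not_or] at hi
    have hi0 : i ∈ ({i₀}ᶜ : Finset (Fin n)) := by simpa using hi.1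
    exact ⟨hi0, not_lt.1 fun hlt => hi.2 (Finset.mem_filter.2 ⟨hi0, hlt⟩)⟩
  calc r * ∑ i ∈ (insert i₀ J)ᶜ, d i ^ 2 = ∑ i ∈ (insert i₀ J)ᶜ, r * d i * d i := by
        rw [Finset.mul_sum]
        exact Finset.sum_congr rfl fun i _ => by ring
    _ ≤ ∑ i ∈ (insert i₀ J)ᶜ, T * d i :=
        Finset.sum_le_sum fun i hi => mul_le_mul_of_nonneg_right (hmem i hi).2 (hd i)
    _ = T * ∑ i ∈ (insert i₀ J)ᶜ, d i := by rw [Finset.mul_sum]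
    _ ≤ T * T := by
        refine mul_le_mul_of_nonneg_left ?_ hT0
        exact Finset.sum_le_sum_of_subset_of_nonneg (fun i hi => (hmem i hi).1) fun i _ _ => hd i
    _ = T ^ 2 := (sq T).symm

/-- For a probability vector `l` with maximal entry `p = l i₀`, the sum of the `α`-th powers of the
other entries is controlled by the entropy, since `t = ∑ i, l i ^ α` is at most `p`, and therefore
`1 - p ≤ -log t`. -/
theorem exists_tail_le_entropy {n : ℕ} (hn : 1 ≤ n) (l : Fin n → ℝ) (hl : ∀ i, 0 ≤ l i)
    (hsum : ∑ i, l i = 1) {α : ℕ} (hα : 2 ≤ α) : ∃ i₀ : Fin n, 0 < ∑ i, l i ^ α ∧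
      ∑ i ∈ {i₀}ᶜ, l i ^ α ≤ ∑ i, l i ^ α ∧
      ∑ i ∈ {i₀}ᶜ, l i ^ α ≤ 2 * (∑ i, l i ^ α) * (-Real.log (∑ i, l i ^ α)) := by
  have : Nonempty (Fin n) := ⟨⟨0, hn⟩⟩
  obtain ⟨i₀, -, hi₀⟩ := Finset.exists_max_image Finset.univ l Finset.univ_nonempty
  set p := l i₀ with hp
  set t := ∑ i, l i ^ α with ht
  set T := ∑ i ∈ {i₀}ᶜ, l i ^ α with hT
  obtain ⟨β, rfl⟩ : ∃ β, α = β + 2 := ⟨α - 2, by omega⟩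
  have hp0 : 0 < p := by
    by_contra hcon
    have h0 : ∑ i, l i ≤ 0 := Finset.sum_nonpos fun i hi => (hi₀ i hi).trans (not_lt.1 hcon)
    linarith
  have hp1 : p ≤ 1 := hsum ▸ Finset.single_le_sum (fun i _ => hl i) (Finset.mem_univ i₀)
  have hpow : ∀ i, l i ^ (β + 2) ≤ p ^ (β + 1) * l i := fun i => by
    rw [pow_succ]
    exact mul_le_mul_of_nonneg_right (pow_le_pow_left₀ (hl i) (hi₀ i (Finset.mem_univ i)) _) (hl i)
  have hsplit : t = p ^ (β + 2) + T := by
    rw [ht, ← Finset.sum_add_sum_compl {i₀}, Finset.sum_singleton]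
  have hsplit1 : p + ∑ i ∈ {i₀}ᶜ, l i = 1 := by
    rw [← hsum, ← Finset.sum_add_sum_compl {i₀} l, Finset.sum_singleton]
  have hT0 : 0 ≤ T := Finset.sum_nonneg fun i _ => pow_nonneg (hl i) _
  have ht0 : 0 < t := by rw [hsplit]; positivity
  have hTle : T ≤ p ^ (β + 1) * (1 - p) := by
    rw [show 1 - p = ∑ i ∈ {i₀}ᶜ, l i by linarith, Finset.mul_sum]
    exact Finset.sum_le_sum fun i _ => hpow i
  have htp : t ≤ p := by
    calc t ≤ ∑ i, p ^ (β + 1) * l i := Finset.sum_le_sum fun i _ => hpow i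
      _ = p ^ (β + 1) := by rw [← Finset.mul_sum, hsum, mul_one]
      _ ≤ p := pow_le_of_le_one hp0.le hp1 (by omega)
  have hlog : 1 - p ≤ -Real.log t := by
    have := Real.log_le_sub_one_of_pos ht0
    linarith
  have hTt : T ≤ t := by
    have : 0 ≤ p ^ (β + 2) := by positivity
    linarith
  refine ⟨i₀, ht0, hTt, ?_⟩
  have hkey : T ≤ 2 * t * (1 - p) := by
    rcases le_total p (1 / 2) with h | h
    · nlinarith
    · have hpt : p ^ (β + 1) ≤ 2 * t := by
        have : p ^ (β + 1) * (1 / 2) ≤ p ^ (β + 2) := by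
          rw [pow_succ p (β + 1)]
          gcongr
        linarith
      exact hTle.trans (mul_le_mul_of_nonneg_right hpt (by linarith))
  exact hkey.trans (mul_le_mul_of_nonneg_left hlog (by positivity))

theorem abs_log_sub_log_le {Z t : ℝ} (ht : 0 < t) (h : |Z - t| ≤ t / 2) :
    0 < Z ∧ |Real.log Z - Real.log t| ≤ 2 * |Z - t| / t := by
  obtain ⟨h1, h2⟩ := abs_le.1 h
  have hZ : 0 < Z := by linarith
  refine ⟨hZ, abs_le.2 ⟨?_, ?_⟩⟩
  · have h3 := Real.log_le_sub_one_of_pos (div_pos ht hZ)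
    rw [Real.log_div ht.ne' hZ.ne'] at h3
    have h4 : t / Z - 1 ≤ 2 * |Z - t| / t := by
      rw [div_sub_one hZ.ne', div_le_div_iff₀ hZ ht]
      nlinarith [neg_abs_le (Z - t), abs_nonneg (Z - t)]
    linarith
  · have h3 := Real.log_le_sub_one_of_pos (div_pos hZ ht)
    rw [Real.log_div hZ.ne' ht.ne'] at h3
    have h4 : Z / t - 1 ≤ 2 * |Z - t| / t := by
      rw [div_sub_one ht.ne']
      gcongr
      linarith [le_abs_self (Z - t), abs_nonneg (Z - t)]
    linarith

/-! ### The normalized kernel matrix -/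

theorem normalizedKernelMatrix_posSemidef {𝒳 : Type*} {κ : 𝒳 → 𝒳 → ℝ}
    (hκ : IsInfinitelyDivisibleKernel κ) {n : ℕ} (x : Fin n → 𝒳) :
    (normalizedKernelMatrix κ x).PosSemidef := by
  have h := hκ.2 1 one_pos n x
  simp only [Real.rpow_one] at h
  have h2 := (h.conjTranspose_mul_mul_same
    (Matrix.diagonal fun i => (√(κ (x i) (x i)))⁻¹)).smul (show (0 : ℝ) ≤ 1 / n by positivity)
  convert h2 using 1
  ext i j
  simp only [normalizedKernelMatrix, Matrix.of_apply, Matrix.smul_apply, smul_eq_mul,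
    Matrix.mul_diagonal, Matrix.diagonal_conjTranspose, Matrix.diagonal_mul, star_trivial]
  rw [Real.sqrt_mul (hκ.1 _ _), div_eq_mul_inv (κ (x i) (x j)), mul_inv]
  ring

theorem trace_normalizedKernelMatrix {𝒳 : Type*} {κ : 𝒳 → 𝒳 → ℝ} {n : ℕ} (hn : 1 ≤ n)
    (x : Fin n → 𝒳) (hx : ∀ i, 0 < κ (x i) (x i)) : (normalizedKernelMatrix κ x).trace = 1 := by
  have h : ∀ i, normalizedKernelMatrix κ x i i = 1 / n := fun i => by
    rw [normalizedKernelMatrix, Matrix.of_apply, Real.sqrt_mul_self (hx i).le, div_self (hx i).ne',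
      mul_one]
  have hn' : (n : ℝ) ≠ 0 := by positivity
  simp [Matrix.trace, h, hn']

theorem pow_conj_diagonal {n : ℕ} {A U : Matrix (Fin n) (Fin n) ℝ} {l : Fin n → ℝ}
    (h1 : U * Uᵀ = 1) (h2 : Uᵀ * U = 1) (hA : A = Uᵀ * Matrix.diagonal l * U) (α : ℕ) :
    A ^ α = Uᵀ * Matrix.diagonal (fun i => l i ^ α) * U := by
  induction α with
  | zero => simp [h2]
  | succ α ih =>
    rw [pow_succ, ih, hA]
    calc Uᵀ * Matrix.diagonal (fun i => l i ^ α) * U * (Uᵀ * Matrix.diagonal l * U)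
        = Uᵀ * (Matrix.diagonal (fun i => l i ^ α) * (U * Uᵀ) * Matrix.diagonal l) * U := by
          simp only [Matrix.mul_assoc]
      _ = _ := by
          rw [h1, Matrix.mul_one, Matrix.diagonal_mul_diagonal]
          simp only [pow_succ]

/-! ### Query count, constants and conclusion -/

theorem orthonormalization_card_le {n k : ℕ}
    {orth : Matrix (Fin n) (Fin k) ℝ → Σ q : ℕ, Matrix (Fin n) (Fin q) ℝ}
    (h : IsOrthonormalization orth) (Y : Matrix (Fin n) (Fin k) ℝ) : (orth Y).1 ≤ k := by
  have h1 : (orth Y).2.rank = Y.rank := by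
    rw [Matrix.rank, Matrix.rank, (h Y).2]
  have h2 : ((orth Y).2ᵀ * (orth Y).2).rank = (orth Y).1 := by
    rw [(h Y).1, Matrix.rank_one, Fintype.card_fin]
  rw [← h2]
  refine (Matrix.rank_mul_le_right _ _).trans ?_
  rw [h1]
  exact Y.rank_le_width

/-- The failure probabilities of the range finder and of the estimator, for `k ≥ 32 * L` and a rank
`r ≤ k / 608`: the latter beats the cardinality `2 ^ (27 * r)` of the net, as `27 * log 2 ≤ 19`. -/
theorem failure_probability_le {k r : ℕ} (hr : 608 * r ≤ k) {L δ : ℝ} (hδ : 0 < δ)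
    (hLδ : L = Real.log (1 / δ) + Real.log 8) (hk : 32 * L ≤ k) :
    (2 ^ (27 * r) + 2) * (2 * Real.exp (-((k : ℝ) / 16))) + 2 * Real.exp (-L) ≤ δ := by
  have hr' : 608 * (r : ℝ) ≤ k := by exact_mod_cast hr
  have hpow : (2 : ℝ) ^ (27 * r) ≤ Real.exp (k / 32) := by
    rw [← Real.exp_log (show (0 : ℝ) < 2 by norm_num), ← Real.exp_nat_mul]
    apply Real.exp_le_exp.2
    push_cast
    have := Real.log_two_lt_d9
    nlinarith [Nat.cast_nonneg (α := ℝ) r]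
  have hone : 1 ≤ Real.exp ((k : ℝ) / 32) := Real.one_le_exp (by positivity)
  have he : Real.exp ((k : ℝ) / 32) * Real.exp (-((k : ℝ) / 16)) ≤ Real.exp (-L) := by
    rw [← Real.exp_add]
    exact Real.exp_le_exp.2 (by linarith)
  have hδ8 : Real.exp (-L) = δ / 8 := by
    rw [hLδ, ← Real.log_mul (by positivity) (by norm_num), Real.exp_neg,
      Real.exp_log (by positivity)]
    field_simp
  calc (2 ^ (27 * r) + 2) * (2 * Real.exp (-((k : ℝ) / 16))) + 2 * Real.exp (-L)
      ≤ (3 * Real.exp (k / 32)) * (2 * Real.exp (-((k : ℝ) / 16))) + 2 * Real.exp (-L) := by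
        gcongr
        linarith
    _ ≤ 8 * Real.exp (-L) := by nlinarith
    _ = δ := by rw [hδ8]; ring

/-- The size of the Hutch++ error in terms of the trace `T` of `B` outside a top eigenvector. -/
theorem error_bound_le {k r m : ℕ} (hm : m = 2 * k) (hk : 0 < k) (hr : k ≤ 1216 * r) {F T L : ℝ}
    (hT : 0 ≤ T) (hL : 0 ≤ L) (hF : r * F ≤ T ^ 2) :
    3 * √(33 * F) * √(L * m) / m ≤ 426 * √L / k * T := by
  have hk' : (0 : ℝ) < k := by exact_mod_cast hk
  have hr' : (k : ℝ) ≤ 1216 * r := by exact_mod_cast hr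
  have hr0 : (0 : ℝ) < r := by linarith
  have hF' : F ≤ 1216 * T ^ 2 / k := by
    rw [le_div_iff₀ hk']
    rcases le_total F 0 with h | h
    · nlinarith [sq_nonneg T]
    · nlinarith
  have hm' : (m : ℝ) = 2 * k := by exact_mod_cast hm
  have h1 : √(33 * F) * √(L * m) ≤ 284 * √L * T := by
    rw [← Real.sqrt_mul' _ (by positivity)]
    refine Real.sqrt_le_iff.2 ⟨by positivity, ?_⟩
    rw [mul_pow, mul_pow, Real.sq_sqrt hL, hm']
    calc 33 * F * (L * (2 * k)) ≤ 33 * (1216 * T ^ 2 / k) * (L * (2 * k)) := by gcongr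
      _ = 80256 * (L * T ^ 2) := by field_simp; ring
      _ ≤ 284 ^ 2 * L * T ^ 2 := by nlinarith [mul_nonneg hL (sq_nonneg T)]
  rw [div_le_iff₀ (by rw [hm']; positivity)]
  calc 3 * √(33 * F) * √(L * m) = 3 * (√(33 * F) * √(L * m)) := by ring
    _ ≤ 3 * (284 * √L * T) := by gcongr
    _ = 426 * √L / k * T * m := by rw [hm']; field_simp; ring

/-- The consequences of a lower bound on `4 * k`, the number of queries. The constant depends on a
lower bound `l₀` for `l`, which absorbs the additive `log 8`. It also makes the relative error `426
* √L / k` at most `1 / 2` when `ε` is large. -/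
theorem sketch_size_bounds {l₀ l ε k : ℝ} (hl₀ : 0 < l₀) (hl : l₀ ≤ l) (hε : 0 < ε)
    (hk : 6816 * (1 + Real.log 8 / l₀) * (1 / ε * √l + l) ≤ 4 * k) :
    2 ≤ l + Real.log 8 ∧ 1704 * (l + Real.log 8) ≤ k ∧
      426 * √(l + Real.log 8) / k ≤ 1 / 2 ∧ 426 * √(l + Real.log 8) / k ≤ ε / 4 := by
  have h8 : 2 ≤ Real.log 8 := by
    rw [show (8 : ℝ) = 2 ^ 3 by norm_num, Real.log_pow]
    have := Real.log_two_gt_d9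
    push_cast
    linarith
  have hl0 : 0 < l := hl₀.trans_le hl
  set a := 1 + Real.log 8 / l₀ with ha
  have ha1 : 1 ≤ a := by
    rw [ha]
    have : 0 ≤ Real.log 8 / l₀ := by positivity
    linarith
  have hLa : l + Real.log 8 ≤ a * l := by
    have : Real.log 8 ≤ Real.log 8 / l₀ * l := by
      rw [div_mul_eq_mul_div, le_div_iff₀ hl₀]
      gcongr
    rw [ha]
    linarith
  set L := l + Real.log 8 with hL
  have hL2 : 2 ≤ L := by linarith
  have hsL : √L ≤ L := by
    rw [Real.sqrt_le_left (by linarith)]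
    nlinarith
  have hsLa : √L ≤ a * √l := by
    calc √L ≤ √(a ^ 2 * l) := Real.sqrt_le_sqrt (hLa.trans (by nlinarith))
      _ = a * √l := by rw [Real.sqrt_mul (by positivity), Real.sqrt_sq (by linarith)]
  have hexp : 6816 * a * (1 / ε * √l + l) = 6816 * (a * √l / ε) + 6816 * (a * l) := by
    field_simp
  rw [hexp] at hk
  have hq : √L / ε ≤ a * √l / ε := by gcongr
  have hq0 : 0 ≤ √L / ε := by positivity
  have hk1 : 1704 * L ≤ k := by linarith
  have hk2 : 1704 * (√L / ε) ≤ k := by nlinarith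
  have hk0 : 0 < k := by linarith
  refine ⟨hL2, hk1, ?_, ?_⟩
  · rw [div_le_iff₀ hk0]
    linarith
  · rw [div_le_iff₀ hk0]
    have h := mul_le_mul_of_nonneg_left hk2 hε.le
    have h2 : ε * (1704 * (√L / ε)) = 1704 * √L := by field_simp
    linarith

/-- The transfer from an additive error of Hutch++, small compared to the trace outside a top
eigenvector, to a relative error of the entropy. -/
theorem abs_renyi_sub_le {α : ℕ} (hα : 2 ≤ α) {Z t T ε e : ℝ} (hε : 0 ≤ ε) (ht : 0 < t)
    (hT0 : 0 ≤ T) (hTt : T ≤ t) (hTlog : T ≤ 2 * t * (-Real.log t)) (he : e ≤ 1 / 2)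
    (heε : e ≤ ε / 4) (hZ : |Z - t| ≤ e * T) :
    0 < Z ∧ |1 / (1 - (α : ℝ)) * Real.log Z - 1 / (1 - (α : ℝ)) * Real.log t| ≤
      ε * (1 / (1 - (α : ℝ)) * Real.log t) := by
  have hα' : (2 : ℝ) ≤ α := by exact_mod_cast hα
  obtain ⟨hZ0, hlog⟩ := abs_log_sub_log_le ht (hZ.trans (by nlinarith : e * T ≤ t / 2))
  refine ⟨hZ0, ?_⟩
  have hmain : |Real.log Z - Real.log t| ≤ ε * (-Real.log t) := by
    refine hlog.trans ?_
    rw [div_le_iff₀ ht]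
    have h1 : e * T ≤ ε / 4 * (2 * t * (-Real.log t)) :=
      (mul_le_mul_of_nonneg_right heε hT0).trans (mul_le_mul_of_nonneg_left hTlog (by positivity))
    linarith
  have hneg : |1 / (1 - (α : ℝ))| = 1 / ((α : ℝ) - 1) := by
    rw [abs_div, abs_one, abs_of_neg (by linarith), neg_sub]
  have hinv : 1 / (1 - (α : ℝ)) = -(1 / ((α : ℝ) - 1)) := by
    rw [← neg_sub (α : ℝ) 1, div_neg]
  rw [← mul_sub, abs_mul, hneg]
  calc 1 / ((α : ℝ) - 1) * |Real.log Z - Real.log t|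
      ≤ 1 / ((α : ℝ) - 1) * (ε * (-Real.log t)) :=
        mul_le_mul_of_nonneg_left hmain (one_div_nonneg.2 (by linarith))
    _ = ε * (1 / (1 - (α : ℝ)) * Real.log t) := by rw [hinv]; ring

theorem mainTheorem6 (δ₀ : ℝ) (hδ₀ : δ₀ < 1) :
    ∃ C : ℝ, 0 < C ∧
      ∀ (𝒳 : Type*) (κ : 𝒳 → 𝒳 → ℝ), IsInfinitelyDivisibleKernel κ →
      ∀ (n : ℕ), 1 ≤ n →
      ∀ (x : Fin n → 𝒳), (∀ i, 0 < κ (x i) (x i)) →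
      ∀ (α : ℕ), 2 ≤ α →
      ∀ (ε δ : ℝ), 0 < ε → 0 < δ → δ ≤ δ₀ →
      ∀ (s : ℕ), 4 ∣ s →
        C * (1 / ε * √(Real.log (1 / δ)) + Real.log (1 / δ)) ≤ (s : ℝ) →
      ∀ (orth : Matrix (Fin n) (Fin (s / 4)) ℝ → Σ q : ℕ, Matrix (Fin n) (Fin q) ℝ),
        IsOrthonormalization orth →
      ∀ (A : Matrix (Fin n) (Fin n) ℝ), A = normalizedKernelMatrix κ x →
        (∀ (S : Matrix (Fin n) (Fin (s / 4)) ℝ) (G : Matrix (Fin n) (Fin (s / 2)) ℝ),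
          (hutchPP s orth S G).queries (A ^ α) ≤ s) ∧
        1 - δ ≤ ((gaussianMatrix n (s / 4)).prod (gaussianMatrix n (s / 2))).real
          {ω | 0 < (hutchPP s orth (Matrix.of ω.1) (Matrix.of ω.2)).output (A ^ α) ∧
            |renyiEstimate α s orth (Matrix.of ω.1) (Matrix.of ω.2) A - renyiEntropy α A| ≤
              ε * renyiEntropy α A} := by
  by_cases hδ₀0 : 0 < δ₀
  swap
  -- no `δ` satisfies `0 < δ ≤ δ₀`
  · exact ⟨1, one_pos, fun 𝒳 κ _ n _ x _ α _ ε δ _ hδ hδ' => absurd (hδ.trans_le hδ') hδ₀0⟩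
  have hl₀ : 0 < Real.log (1 / δ₀) := Real.log_pos (by rwa [lt_div_iff₀ hδ₀0, one_mul])
  have hlog8 : 0 < Real.log 8 := Real.log_pos (by norm_num)
  refine ⟨6816 * (1 + Real.log 8 / Real.log (1 / δ₀)), by positivity, ?_⟩
  intro 𝒳 κ hκ n hn x hx α hα ε δ hε hδ hδ' s hs4 hs orth horth A hA
  refine ⟨fun S G => ?_, ?_⟩
  · rw [queries_hutchPP]
    have := orthonormalization_card_le horth (A ^ α * S)
    omega
  have hsk : s = 4 * (s / 4) := by omega
  set l := Real.log (1 / δ) with hl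
  have hll : Real.log (1 / δ₀) ≤ l :=
    Real.log_le_log (by positivity) (one_div_le_one_div_of_le hδ hδ')
  have hsk' : (s : ℝ) = 4 * (s / 4 : ℕ) := by exact_mod_cast hsk
  obtain ⟨hL2, hkL, he1, he2⟩ := sketch_size_bounds (k := (s / 4 : ℕ)) hl₀ hll hε (hs.trans_eq hsk')
  set L := l + Real.log 8 with hL
  have hk608 : (608 : ℝ) ≤ (s / 4 : ℕ) := by linarith
  have hk608' : 608 ≤ s / 4 := by exact_mod_cast hk608
  -- the spectrum of `A`, and the part of it that the sketch resolves
  have hpsd : A.PosSemidef := hA ▸ normalizedKernelMatrix_posSemidef hκ x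
  have htrA : A.trace = 1 := hA ▸ trace_normalizedKernelMatrix hn x hx
  obtain ⟨U, h1, h2, hAU⟩ := exists_orthogonal_diagonalization hpsd.1
  set lam := hpsd.1.eigenvalues with hlam
  have hlam0 : ∀ i, 0 ≤ lam i := hpsd.eigenvalues_nonneg
  have htrace : ∀ d : Fin n → ℝ, (Uᵀ * Matrix.diagonal d * U).trace = ∑ i, d i := fun d => by
    rw [Matrix.trace_mul_comm, ← Matrix.mul_assoc, h1, Matrix.one_mul, Matrix.trace_diagonal]
  have hsum : ∑ i, lam i = 1 := by rw [← htrace, ← hAU, htrA]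
  have hB := pow_conj_diagonal h1 h2 hAU α
  have htrB : (A ^ α).trace = ∑ i, lam i ^ α := by rw [hB, htrace]
  obtain ⟨i₀, ht0, hTt, hTlog⟩ := exists_tail_le_entropy hn lam hlam0 hsum hα
  obtain ⟨I, hI, hIF⟩ := exists_large_indices (fun i => lam i ^ α)
    (fun i => pow_nonneg (hlam0 i) α) i₀ (r := s / 4 / 608) (by omega)
  have hT0 : 0 ≤ ∑ i ∈ {i₀}ᶜ, lam i ^ α := Finset.sum_nonneg fun i _ => pow_nonneg (hlam0 i) α
  rw [← htrB] at ht0 hTt hTlog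
  have hm : s / 2 = 2 * (s / 4) := by omega
  have hm' : ((s / 2 : ℕ) : ℝ) = 2 * (s / 4 : ℕ) := by exact_mod_cast hm
  have hbad := measure_hutchPP_error_le (L := L) horth (by omega) (by omega) h1 h2 hB I hI
    (by linarith) (by rw [hm']; linarith)
  have hprob := hbad.trans (failure_probability_le (by omega) hδ hL (by linarith))
  have herr := error_bound_le (r := s / 4 / 608) hm (by omega) (by omega) hT0
    (show 0 ≤ L by linarith) hIF
  set P := (gaussianMatrix n (s / 4)).prod (gaussianMatrix n (s / 2)) with hP
  set E := {ω : (Fin n → Fin (s / 4) → ℝ) × (Fin n → Fin (s / 2) → ℝ) |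
    3 * √(33 * ∑ i ∈ Iᶜ, (lam i ^ α) ^ 2) * √(L * (s / 2 : ℕ)) / (s / 2 : ℕ) <
      |(hutchPP s orth (Matrix.of ω.1) (Matrix.of ω.2)).output (A ^ α) - (A ^ α).trace|} with hE
  set good := {ω : (Fin n → Fin (s / 4) → ℝ) × (Fin n → Fin (s / 2) → ℝ) |
    0 < (hutchPP s orth (Matrix.of ω.1) (Matrix.of ω.2)).output (A ^ α) ∧
      |renyiEstimate α s orth (Matrix.of ω.1) (Matrix.of ω.2) A - renyiEntropy α A| ≤
        ε * renyiEntropy α A} with hgood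
  have hcover : E ∪ good = Set.univ := by
    refine Set.eq_univ_of_forall fun ω => or_iff_not_imp_left.2 fun hω => ?_
    have hω' := (not_lt.1 fun hlt => hω hlt :
      |(hutchPP s orth (Matrix.of ω.1) (Matrix.of ω.2)).output (A ^ α) - (A ^ α).trace| ≤ _)
    exact abs_renyi_sub_le hα hε.le ht0 hT0 hTt hTlog he1 he2 (hω'.trans herr)
  -- the event need not be measurable, but outer measures are subadditive
  have huniv : 1 ≤ P.real E + P.real good := by
    refine le_trans (le_of_eq ?_) (measureReal_union_le E good)
    rw [hcover, probReal_univ]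
  linarith
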